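/- Let $k$ be an algebraically closed field of characteristic $p>0$, let $\mathbf V$ be a $k$-vector space with countably infinite basis $(e_i)_{i\in\mathbb N}$, let $\mathbf{GL}=\bigcup_n \mathbf{GL}_n(k)$ be the group of automorphisms of $\mathbf V$ fixing all but finitely many of the $e_i$, and let $R=\bigwedge(\mathbf V)$ be the exterior algebra with its natural $\mathbf{GL}$-action. A representation of $\mathbf{GL}$ over $k$ is *polynomial* if it is a subquotient of a (possibly infinite) direct sum of tensor powers of $\mathbf V$. Let $\mathrm{Mod}_R$ be the category of $R$-modules $M$ with a $k$-linear action of $\mathbf{GL}$ that makes $M$ a polynomial representation and satisfies $g(am)=g(a)g(m)$ for $g\in\mathbf{GL}$, $a\in R$, $m\in M$; morphisms are the $\mathbf{GL}$-equivariant $R$-linear maps. Call a $\mathbf{GL}$-stable $R$-submodule of such an $M$ finitely generated if it is generated as an $R$-module by the $\mathbf{GL}$-orbits of finitely many elements. Then: 1. The category $\mathrm{Mod}_R$ is locally noetherian: it is a Grothendieck abelian category with a (small) generating family of noetherian objects. 2. If $M\in\mathrm{Mod}_R$ is finitely generated, then every $\mathbf{GL}$-stable $R$-submodule of $M$ is finitely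 generated. 3. For $n\ge 0$ let $P_n=R\otimes_k\mathbf V^{\otimes n}$, on which the monoid $\mathrm{Inc}(\mathbb N)$ of strictly increasing maps $\sigma:\mathbb N\to\mathbb N$ acts by $$\sigma\bigl((e_{i_1}\wedge\dots\wedge e_{i_r})\otimes(e_{j_1}\otimes\dots\otimes e_{j_n})\bigr)=(e_{\sigma(i_1)}\wedge\dots\wedge e_{\sigma(i_r)})\otimes(e_{\sigma(j_1)}\otimes\dots\otimes e_{\sigma(j_n)}).$$ Every $\mathrm{Inc}(\mathbb N)$-stable $R$-submodule of $P_n$ is generated as an $R$-module by the $\mathrm{Inc}(\mathbb N)$-orbits of finitely many elements. -/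

import Mathlib

open CategoryTheory TensorProduct

universe u v w

noncomputable section

namespace ExtNoeth

/-- The vector space `𝐕` with countable basis `e_i = Finsupp.single i 1`, `i : ℕ`. -/
abbrev V (k : Type u) [Field k] : Type u := ℕ →₀ k

/-- The infinite general linear group `GL = ⋃ₙ GL_n(k)`: the automorphisms of `𝐕` fixing all but
finitely many of the basis vectors. -/
def GLinf (k : Type u) [Field k] : Subgroup (V k ≃ₗ[k] V k) where
  carrier := {g | ∃ n : ℕ, ∀ i, n ≤ i → g (Finsupp.single i 1) = Finsupp.single i 1}
  one_mem' := ⟨0, fun _ _ => rfl⟩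
  mul_mem' := by
    rintro g h ⟨m, hm⟩ ⟨n, hn⟩
    refine ⟨max m n, fun i hi => ?_⟩
    rw [LinearEquiv.mul_apply, hn i (le_of_max_le_right hi), hm i (le_of_max_le_left hi)]
  inv_mem' := by
    rintro g ⟨n, hn⟩
    refine ⟨n, fun i hi => ?_⟩
    exact (LinearEquiv.symm_apply_eq g).2 (hn i hi).symm

/-- The exterior algebra `R = ⋀(𝐕)`. -/
abbrev R (k : Type u) [Field k] : Type u := ExteriorAlgebra k (V k)

/-- The action of `g ∈ GL` on `R` by the algebra map that extends `g` on `𝐕`. -/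
def actR {k : Type u} [Field k] (g : GLinf k) : R k →ₐ[k] R k :=
  ExteriorAlgebra.map (g.1 : V k →ₗ[k] V k)

/-- The representation of `GL` on the tensor power `𝐕^{⊗ n}`. -/
def tensorRep (k : Type u) [Field k] (n : ℕ) : Representation k (GLinf k) (⨂[k]^n (V k)) where
  toFun g := PiTensorProduct.map fun _ => (g.1 : V k →ₗ[k] V k)
  map_one' := PiTensorProduct.map_one
  map_mul' g h := PiTensorProduct.map_mul (fun _ : Fin n => (g.1 : V k →ₗ[k] V k))
    fun _ => (h.1 : V k →ₗ[k] V k)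

/-- A representation of `GL` is polynomial if it is a subquotient (a quotient of a
subrepresentation) of a possibly infinite direct sum of tensor powers of `𝐕`. -/
def IsPolynomial {k : Type u} [Field k] {M : Type u} [AddCommMonoid M] [Module k M]
    (ρ : Representation k (GLinf k) M) : Prop :=
  ∃ (ι : Type u) (d : ι → ℕ)
    (S : Subrepresentation (Representation.directSum fun i => tensorRep k (d i)))
    (f : Representation.IntertwiningMap S.toRepresentation ρ), Function.Surjective f

/-- An object of `Mod_R`: a left module over the exterior algebra `R` with a compatible action of
`GL`, under which it is a polynomial representation. -/
structure ModR (k : Type u) [Field k] where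
  carrier : Type u
  [addCommGroup : AddCommGroup carrier]
  [moduleBase : Module k carrier]
  [module : Module (R k) carrier]
  [isScalarTower : IsScalarTower k (R k) carrier]
  /-- the action of `GL` -/
  ρ : Representation k (GLinf k) carrier
  ρ_smul : ∀ (g : GLinf k) (a : R k) (m : carrier), ρ g (a • m) = actR g a • ρ g m
  polynomial : IsPolynomial ρ

namespace ModR

variable {k : Type u} [Field k]

attribute [instance] addCommGroup moduleBase module isScalarTower

instance : CoeSort (ModR k) (Type u) := ⟨carrier⟩

/-- Morphisms of `Mod_R`: the `GL`-equivariant `R`-linear maps. -/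
@[ext]
structure Hom (M N : ModR k) where
  toLin : M →ₗ[R k] N
  equivariant : ∀ (g : GLinf k) (m : M), toLin (M.ρ g m) = N.ρ g (toLin m)

instance : Category.{u} (ModR k) where
  Hom M N := Hom M N
  id M := ⟨LinearMap.id, fun _ _ => rfl⟩
  comp f h := ⟨h.toLin ∘ₗ f.toLin, fun g m => by
    simp only [LinearMap.comp_apply, f.equivariant, h.equivariant]⟩

/-- An `R`-submodule of `M` is `GL`-stable; the `GL`-stable `R`-submodules are the submodules of `M`
in `Mod_R`. -/
def IsStable (M : ModR k) (N : Submodule (R k) M) : Prop :=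
  ∀ (g : GLinf k), ∀ m ∈ N, M.ρ g m ∈ N

/-- A submodule is generated over `R` by the `GL`-orbits of finitely many elements. -/
def IsFG (M : ModR k) (N : Submodule (R k) M) : Prop :=
  ∃ s : Finset M, Submodule.span (R k) {x : M | ∃ (g : GLinf k), ∃ m ∈ s, x = M.ρ g m} = N

end ModR

/-- A locally noetherian category: a Grothendieck abelian category having a small family of
noetherian objects that is a family of generators. -/
def IsLocallyNoetherian (C : Type v) [Category.{w} C] : Prop :=
  ∃ _ : Abelian C, IsGrothendieckAbelian.{w} C ∧
    ∃ (I : Type w) (G : I → C),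
      (ObjectProperty.ofObj G).IsSeparating ∧ ∀ i, IsNoetherianObject (G i)

/-- The `R`-module `P_n = R ⊗ 𝐕^{⊗ n}`, with `R` acting on the first factor. -/
abbrev P (k : Type u) [Field k] (n : ℕ) : Type u := R k ⊗[k] (⨂[k]^n (V k))

/-- The action on `P_n` of an element `σ` of the increasing monoid `Inc(ℕ)` of strictly increasing
maps `ℕ → ℕ`, induced by `e_i ↦ e_{σ(i)}` on all the factors. -/
def incAct (k : Type u) [Field k] (n : ℕ) (σ : ℕ ↪o ℕ) : P k n →ₗ[k] P k n :=
  TensorProduct.map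
    (ExteriorAlgebra.map (Finsupp.lmapDomain k k σ)).toLinearMap
    (PiTensorProduct.map fun _ => Finsupp.lmapDomain k k σ)

/-- An `R`-submodule of `P_n` is `Inc(ℕ)`-stable. -/
def IsIncStable {k : Type u} [Field k] {n : ℕ} (N : Submodule (R k) (P k n)) : Prop :=
  ∀ (σ : ℕ ↪o ℕ), ∀ m ∈ N, incAct k n σ m ∈ N

/-- A submodule of `P_n` is generated over `R` by the `Inc(ℕ)`-orbits of finitely many elements. -/
def IsIncFG {k : Type u} [Field k] {n : ℕ} (N : Submodule (R k) (P k n)) : Prop :=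
  ∃ s : Finset (P k n),
    Submodule.span (R k) {x : P k n | ∃ (σ : ℕ ↪o ℕ), ∃ m ∈ s, x = incAct k n σ m} = N

end ExtNoeth

end

noncomputable section

namespace ExtNoeth

/-! ### Finite generation from leading monomials -/

section LeadingTerms

/-! The third assertion is a Gröbner basis argument. Up to sign, `P_n` is spanned by monomials `e_I
⊗ e_J` with `I` a finite set and `J` a word of length `n`. Applying `σ` and then multiplying by some
`e_K` sends a monomial to zero or to plus or minus a monomial, and the monomials have a well-order
that these operators respect (`exists_operator_of_divides`). Divisibility under such operators is a
well-quasi-order by Higman's lemma (`wellQuasiOrdered_divides`), so finitely many leading monomials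
suffice and division terminates (`exists_finset_le_span_of_wellQuasiOrdered`).

For the second assertion, objects of `Mod_R` are viewed as modules over the skew group ring of `GL`
over `R`. On any single element of `P_n` a map `σ` acts like some `g` in `GL`, so `GL`-stable
submodules are `Inc(ℕ)`-stable and `P_n` is noetherian. An element of a polynomial representation
satisfies all group algebra relations common to some finite list of tensors. Hence it is the image
of a vector in a subrepresentation `S` of a finite direct sum of tensor powers. By flatness `R ⊗ S`
embeds in a finite sum of modules `P_d`, so the submodule generated by the element is noetherian
(`isNoetherian_span_singleton`), and finite sums of such submodules are too.

For the first assertion, the elementwise form of polynomiality identifies `Mod_R` with a full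
subcategory of modules over the skew group ring. It is closed under subobjects, quotients, finite
limits and colimits, hence abelian with exact filtered colimits, and its cyclic objects are
noetherian generators. -/

theorem _root_.WellQuasiOrdered.exists_finset_dominating {X : Type*} {D : X → X → Prop}
    (hD : WellQuasiOrdered D) (L : Set X) :
    ∃ t : Finset X, ↑t ⊆ L ∧ ∀ x ∈ L, ∃ z ∈ t, D z x := by
  by_contra! h
  -- Choosing repeatedly an element dominated by no earlier one produces a bad sequence.
  obtain ⟨f, -, hf⟩ := exists_seq_of_forall_finset_exists (fun x => x ∈ L) (fun x y => ¬ D x y)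
    fun s hs => by
      obtain ⟨x, hx, h'⟩ := h s hs
      exact ⟨x, hx, h'⟩
  obtain ⟨m, n, hmn, hm⟩ := hD f
  exact hf m n hmn hm

variable {k W X : Type*} [Field k] [AddCommGroup W] [Module k W] [LinearOrder X]

/-- A finite combination involves a largest index. With `A = Iio x` this turns a strict bound into a
non-strict bound at a smaller index, which drives the induction in the division algorithm. -/
theorem eq_zero_or_mem_span_Iic (e : X → W) (A : Set X) {w : W}
    (hw : w ∈ Submodule.span k (e '' A)) :
    w = 0 ∨ ∃ y ∈ A, w ∈ Submodule.span k (e '' Set.Iic y) := by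
  induction hw using Submodule.span_induction with
  | mem x hx =>
    obtain ⟨y, hy, rfl⟩ := hx
    exact .inr ⟨y, hy, Submodule.subset_span ⟨y, le_rfl, rfl⟩⟩
  | zero => exact .inl rfl
  | add x y _ _ hx hy =>
    rcases hx with rfl | ⟨a, ha, hx⟩
    · simpa using hy
    rcases hy with rfl | ⟨b, hb, hy⟩
    · exact .inr ⟨a, ha, by simpa using hx⟩
    have mono {c d : X} (h : c ≤ d) :
        Submodule.span k (e '' Set.Iic c) ≤ Submodule.span k (e '' Set.Iic d) :=
      Submodule.span_mono (Set.image_mono (Set.Iic_subset_Iic.2 h))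
    rcases le_total a b with h | h
    · exact .inr ⟨b, hb, add_mem (mono h hx) hy⟩
    · exact .inr ⟨a, ha, add_mem hx (mono h hy)⟩
  | smul c x _ hx =>
    rcases hx with rfl | ⟨a, ha, hx⟩
    · exact .inl (smul_zero c)
    · exact .inr ⟨a, ha, Submodule.smul_mem _ c hx⟩

/-- A Gröbner basis argument: if the operators in `𝒯` act on a spanning family indexed by a
well-order compatibly with leading terms, and divisibility of leading terms is a well-quasi-order,
then a `𝒯`-stable subspace is spanned by the translates of finitely many of its elements. -/
theorem exists_finset_le_span_of_wellQuasiOrdered [WellFoundedLT X] (e : X → W)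
    (he : Submodule.span k (Set.range e) = ⊤) {D : X → X → Prop} (hD : WellQuasiOrdered D)
    (𝒯 : Set (W →ₗ[k] W))
    (hT : ∀ x y, D x y → ∃ T ∈ 𝒯, ∃ c : k, c ≠ 0 ∧ T (e x) = c • e y ∧
      ∀ z < x, T (e z) ∈ Submodule.span k (e '' Set.Iio y))
    (N : Submodule k W) (hN : ∀ T ∈ 𝒯, ∀ w ∈ N, T w ∈ N) :
    ∃ s : Finset W, ↑s ⊆ (N : Set W) ∧
      N ≤ Submodule.span k {w | ∃ T ∈ 𝒯, ∃ m ∈ s, w = T m} := by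
  classical
  -- The leading indices of elements of `N` with leading coefficient one. Since `e` is only assumed
  -- to span, an element may have several leading indices.
  let L : Set X := {x | ∃ f ∈ N, f - e x ∈ Submodule.span k (e '' Set.Iio x)}
  obtain ⟨t, htL, ht⟩ := hD.exists_finset_dominating L
  choose! f hfN hf using fun x (hx : x ∈ L) => hx
  refine ⟨t.image f, ?_, ?_⟩
  · intro w hw
    obtain ⟨x, hx, rfl⟩ := Finset.mem_image.1 (Finset.mem_coe.1 hw)
    exact hfN x (htL hx)
  set S := Submodule.span k {w | ∃ T ∈ 𝒯, ∃ m ∈ t.image f, w = T m} with hS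
  have key : ∀ x, ∀ w ∈ N, w ∈ Submodule.span k (e '' Set.Iic x) → w ∈ S := by
    intro x
    induction x using WellFoundedLT.induction with
    | ind x ih =>
      have lower : ∀ w ∈ N, w ∈ Submodule.span k (e '' Set.Iio x) → w ∈ S := by
        intro w hw hwx
        rcases eq_zero_or_mem_span_Iic e _ hwx with rfl | ⟨y, hy, hwy⟩
        · exact zero_mem _
        · exact ih y hy w hw hwy
      intro w hw hwx
      rw [← Set.Iio_insert, Set.image_insert_eq, Submodule.mem_span_insert] at hwx
      obtain ⟨c, w', hw', rfl⟩ := hwx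
      by_cases hc : c = 0
      · subst hc
        exact lower _ hw (by simpa using hw')
      have hxL : x ∈ L := by
        refine ⟨c⁻¹ • (c • e x + w'), N.smul_mem _ hw, ?_⟩
        rw [smul_add, inv_smul_smul₀ hc, add_sub_cancel_left]
        exact Submodule.smul_mem _ _ hw'
      obtain ⟨z, hz, hzx⟩ := ht x hxL
      obtain ⟨T, hT𝒯, c', hc', hTz, hTlow⟩ := hT z x hzx
      have hTS : T (f z) ∈ S :=
        Submodule.subset_span ⟨T, hT𝒯, f z, Finset.mem_image_of_mem f hz, rfl⟩
      have hTN : T (f z) ∈ N := hN T hT𝒯 _ (hfN z (htL hz))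
      have hlow : T (f z - e z) ∈ Submodule.span k (e '' Set.Iio x) := by
        have : Submodule.span k (e '' Set.Iio z) ≤
            (Submodule.span k (e '' Set.Iio x)).comap T := by
          rw [Submodule.span_le]
          rintro _ ⟨y, hy, rfl⟩
          exact hTlow y hy
        exact this (hf z (htL hz))
      -- One step of division: the factor `c / c'` cancels the term at `x`, and the remainder lies
      -- below `x`.
      have hdiff : (c • e x + w') - (c / c') • T (f z) ∈ S := by
        refine lower _ (sub_mem hw (N.smul_mem _ hTN)) ?_
        have : (c • e x + w') - (c / c') • T (f z) = w' - (c / c') • T (f z - e z) := by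
          rw [map_sub, hTz, smul_sub, smul_smul, div_mul_cancel₀ c hc']
          abel
        rw [this]
        exact sub_mem hw' (Submodule.smul_mem _ _ hlow)
      simpa using add_mem hdiff (S.smul_mem (c / c') hTS)
  intro w hw
  have hw' : w ∈ Submodule.span k (e '' Set.univ) := by rw [Set.image_univ, he]; trivial
  rcases eq_zero_or_mem_span_Iic e _ hw' with rfl | ⟨y, -, hwy⟩
  · exact zero_mem _
  · exact key y w hw hwy

end LeadingTerms

/-! ### Monomials of `P_n` -/

variable {k : Type u} [Field k]

/-- The product in `R` of the basis vectors indexed by the letters of a word. -/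
def wedgeWord (k : Type u) [Field k] (l : List ℕ) : R k :=
  (l.map fun i => ExteriorAlgebra.ι k (Finsupp.single i (1 : k))).prod

theorem wedgeWord_append (l l' : List ℕ) :
    wedgeWord k (l ++ l') = wedgeWord k l * wedgeWord k l' := by
  simp [wedgeWord]

/-- Adjacent letters anticommute. The sign is not tracked, as leading coefficients need only be
nonzero. -/
theorem wedgeWord_of_perm {l l' : List ℕ} (h : l.Perm l') :
    wedgeWord k l = wedgeWord k l' ∨ wedgeWord k l = - wedgeWord k l' := by
  induction h with
  | nil => exact .inl rfl
  | cons x _ ih =>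
    simp only [wedgeWord, List.map_cons, List.prod_cons] at ih ⊢
    rcases ih with h | h <;> simp [h]
  | swap x y l =>
    right
    simp only [wedgeWord, List.map_cons, List.prod_cons, ← mul_assoc]
    rw [eq_neg_of_add_eq_zero_left (ExteriorAlgebra.ι_add_mul_swap _ _), neg_mul]
  | trans _ _ ih ih' => rcases ih with h | h <;> rcases ih' with h' | h' <;> simp [h, h']

/-- A permutation brings two equal letters to the front, where their product is a square `ι v * ι v
= 0`. -/
theorem wedgeWord_of_not_nodup {l : List ℕ} (h : ¬ l.Nodup) : wedgeWord k l = 0 := by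
  obtain ⟨x, hx⟩ := List.exists_duplicate_iff_not_nodup.2 h
  obtain ⟨l', hl'⟩ := (List.duplicate_iff_sublist.1 hx).exists_perm_append
  have : wedgeWord k ([x, x] ++ l') = 0 := by
    simp [wedgeWord, ← mul_assoc]
  rcases wedgeWord_of_perm (k := k) hl' with h | h <;> rw [h, this]
  exact neg_zero

theorem wedgeWord_of_toFinset {l : List ℕ} {I : Finset ℕ} (hl : l.Nodup) (h : l.toFinset = I) :
    wedgeWord k l = wedgeWord k I.toList ∨ wedgeWord k l = - wedgeWord k I.toList := by
  subst h
  exact wedgeWord_of_perm (List.toFinset_toList hl).symm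

theorem map_wedgeWord (σ : ℕ → ℕ) (l : List ℕ) :
    ExteriorAlgebra.map (Finsupp.lmapDomain k k σ) (wedgeWord k l) = wedgeWord k (l.map σ) := by
  simp [wedgeWord, map_list_prod, Function.comp_def, ExteriorAlgebra.map_apply_ι]

/-- The span is stable under left multiplication by the generators `ι v`, hence is a left ideal, and
it contains the empty word `1`. -/
theorem span_wedgeWord :
    Submodule.span k (Set.range fun I : Finset ℕ => wedgeWord k I.toList) = ⊤ := by
  set S := Submodule.span k (Set.range fun I : Finset ℕ => wedgeWord k I.toList)
  have hword : ∀ l, wedgeWord k l ∈ S := by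
    intro l
    by_cases hl : l.Nodup
    · rcases wedgeWord_of_toFinset (k := k) hl rfl with h | h <;> rw [h]
      · exact Submodule.subset_span ⟨_, rfl⟩
      · exact neg_mem (Submodule.subset_span ⟨_, rfl⟩)
    · rw [wedgeWord_of_not_nodup hl]
      exact zero_mem _
  have hι : ∀ v : V k, ∀ x ∈ S, ExteriorAlgebra.ι k v * x ∈ S := by
    intro v x hx
    induction v using Finsupp.induction_linear with
    | zero => simp
    | add f g hf hg => rw [map_add, add_mul]; exact add_mem hf hg
    | single i a =>
      have : Finsupp.single i a = a • Finsupp.single i (1 : k) := by simp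
      rw [this, map_smul, smul_mul_assoc]
      refine S.smul_mem a ?_
      induction hx using Submodule.span_induction with
      | mem x hx =>
        obtain ⟨I, rfl⟩ := hx
        simpa [wedgeWord] using hword (i :: I.toList)
      | zero => simp
      | add x y _ _ hx hy => rw [mul_add]; exact add_mem hx hy
      | smul c x _ hx => rw [mul_smul_comm]; exact S.smul_mem c hx
  have hmul : ∀ a x : R k, x ∈ S → a * x ∈ S := by
    intro a
    induction a using ExteriorAlgebra.induction with
    | algebraMap r => intro x hx; rw [← Algebra.smul_def]; exact S.smul_mem r hx
    | ι v => exact hι v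
    | mul a b ha hb => intro x hx; rw [mul_assoc]; exact ha _ (hb _ hx)
    | add a b ha hb => intro x hx; rw [add_mul]; exact add_mem (ha _ hx) (hb _ hx)
  refine eq_top_iff.2 fun a _ => ?_
  simpa using hmul a 1 (by simpa [wedgeWord] using hword [])

/-- The tensor `e_{J 0} ⊗ ⋯ ⊗ e_{J (n-1)}`. -/
def tensorWord (k : Type u) [Field k] {n : ℕ} (J : Fin n → ℕ) : ⨂[k]^n (V k) :=
  PiTensorProduct.tprod k fun t => Finsupp.single (J t) (1 : k)

theorem span_tensorWord (n : ℕ) :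
    Submodule.span k (Set.range (tensorWord k (n := n))) = ⊤ := by
  rw [← (Basis.piTensorProduct fun _ : Fin n => Finsupp.basisSingleOne (R := k) (ι := ℕ)).span_eq]
  congr 2
  ext J
  simp [tensorWord, Basis.piTensorProduct_apply]

/-- The order on the monomials of `P_n`: lexicographic on the tensor factors, then colexicographic
on the exterior factor. -/
abbrev MonoIndex (n : ℕ) : Type := Lex (Lex (Fin n → ℕ) × Colex (Finset ℕ))

/-- Reading a finite set as binary digits, `I ↦ ∑ 2 ^ i`, is strictly monotone from colex to `ℕ`. -/
instance : WellFoundedLT (Colex (Finset ℕ)) :=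
  (Finset.geomSum_ofColex_strictMono (n := 2) le_rfl).wellFoundedLT

/-- The exterior part of a monomial. -/
def MonoIndex.ext {n : ℕ} (x : MonoIndex n) : Finset ℕ := ofColex (ofLex x).2

/-- The tensor part of a monomial. -/
def MonoIndex.word {n : ℕ} (x : MonoIndex n) : Fin n → ℕ := ofLex (ofLex x).1

theorem MonoIndex.lt_iff {n : ℕ} {x y : MonoIndex n} :
    x < y ↔ toLex x.word < toLex y.word ∨
      x.word = y.word ∧ toColex x.ext < toColex y.ext := by
  rw [Prod.Lex.lt_iff]
  rfl

/-- The index of the monomial with prescribed exterior and tensor part. -/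
def MonoIndex.mk {n : ℕ} (I : Finset ℕ) (J : Fin n → ℕ) : MonoIndex n := toLex (toLex J, toColex I)

/-- The monomials of `P_n`. -/
def monomial (k : Type u) [Field k] {n : ℕ} (x : MonoIndex n) : P k n :=
  wedgeWord k x.ext.toList ⊗ₜ tensorWord k x.word

theorem span_monomial (n : ℕ) : Submodule.span k (Set.range (monomial k (n := n))) = ⊤ := by
  rw [← TensorProduct.map₂_mk_top_top_eq_top, ← span_wedgeWord, ← span_tensorWord,
    Submodule.map₂_span_span]
  congr 1
  ext p
  constructor
  · rintro ⟨x, rfl⟩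
    exact ⟨_, ⟨x.ext, rfl⟩, _, ⟨x.word, rfl⟩, rfl⟩
  · rintro ⟨_, ⟨I, rfl⟩, _, ⟨J, rfl⟩, rfl⟩
    exact ⟨.mk I J, rfl⟩

theorem incAct_monomial {n : ℕ} (σ : ℕ ↪o ℕ) (x : MonoIndex n) :
    incAct k n σ (monomial k x) =
      wedgeWord k (x.ext.toList.map σ) ⊗ₜ tensorWord k (fun t => σ (x.word t)) := by
  simp [incAct, monomial, map_wedgeWord, tensorWord, PiTensorProduct.map_tprod]

/-! ### Divisibility of monomials: compatibility with the order, and well-quasi-ordering -/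

/-- Divisibility of monomials up to the action of `Inc(ℕ)`. -/
def Divides {n : ℕ} (x y : MonoIndex n) : Prop :=
  ∃ σ : ℕ ↪o ℕ, x.ext.image σ ⊆ y.ext ∧ ∀ t, σ (x.word t) = y.word t

theorem nodup_append_map_of_disjoint {I K : Finset ℕ} (σ : ℕ ↪o ℕ) (h : Disjoint K (I.image σ)) :
    (K.toList ++ I.toList.map σ).Nodup := by
  rw [List.nodup_append']
  refine ⟨K.nodup_toList, I.nodup_toList.map σ.injective, ?_⟩
  rw [Finset.disjoint_left] at h
  intro a ha hb
  refine h (Finset.mem_toList.1 ha) ?_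
  simpa using hb

/-- The operator applies `σ` and multiplies by `e_K`, where `K` is the part of `y.ext` outside the
image of `x.ext`. A strictly increasing map preserves lex and colex comparisons, and so does
adjoining a disjoint `K`; a monomial whose image meets `K` is killed. -/
theorem exists_operator_of_divides {n : ℕ} {x y : MonoIndex n} (h : Divides x y) :
    ∃ (a : R k) (σ : ℕ ↪o ℕ) (c : k), c ≠ 0 ∧
      a • incAct k n σ (monomial k x) = c • monomial k y ∧
      ∀ z < x, a • incAct k n σ (monomial k z) ∈
        Submodule.span k (monomial k '' Set.Iio y) := by
  obtain ⟨σ, hI, hJ⟩ := h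
  set K := y.ext \ x.ext.image σ
  have hact : ∀ z : MonoIndex n, wedgeWord k K.toList • incAct k n σ (monomial k z) =
      wedgeWord k (K.toList ++ z.ext.toList.map σ) ⊗ₜ tensorWord k (fun t => σ (z.word t)) := by
    intro z
    rw [incAct_monomial, TensorProduct.smul_tmul', smul_eq_mul, wedgeWord_append]
  refine ⟨wedgeWord k K.toList, σ, ?_⟩
  have htop : ∃ c : k, c ≠ 0 ∧ wedgeWord k K.toList • incAct k n σ (monomial k x) =
      c • monomial k y := by
    have hset : (K.toList ++ x.ext.toList.map σ).toFinset = y.ext := by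
      ext i
      simp only [K, List.toFinset_append, Finset.toList_toFinset, List.mem_toFinset,
        Finset.mem_union, Finset.mem_sdiff, List.mem_map, Finset.mem_toList]
      have := @hI i
      simp only [Finset.mem_image] at this ⊢
      exact ⟨fun h => h.elim And.left this, fun h => (em _).elim .inr fun h' => .inl ⟨h, h'⟩⟩
    have hw : (fun t => σ (x.word t)) = y.word := funext hJ
    rw [hact, hw]
    rcases wedgeWord_of_toFinset (k := k) (nodup_append_map_of_disjoint σ Finset.sdiff_disjoint) hset with h | h
    · exact ⟨1, one_ne_zero, by rw [h, one_smul, monomial]⟩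
    · exact ⟨-1, neg_ne_zero.2 one_ne_zero, by
        rw [h, TensorProduct.neg_tmul]
        exact (neg_one_smul k (monomial k y)).symm⟩
  obtain ⟨c, hc, hcx⟩ := htop
  refine ⟨c, hc, hcx, fun z hz => ?_⟩
  rw [hact]
  by_cases hd : Disjoint K (z.ext.image σ)
  · have hlt : MonoIndex.mk (K ∪ z.ext.image σ) (fun t => σ (z.word t)) < y := by
      rw [MonoIndex.lt_iff] at hz ⊢
      change toLex (fun t => σ (z.word t)) < _ ∨ (fun t => σ (z.word t)) = _ ∧
        toColex (K ∪ z.ext.image σ) < _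
      have hw : y.word = fun t => σ (x.word t) := (funext hJ).symm
      rcases hz with ⟨i, hi, hlt⟩ | ⟨hw', hlt⟩
      · left
        refine ⟨i, fun j hj => ?_, ?_⟩
        · rw [hw]
          exact congrArg σ (hi j hj)
        · rw [hw]
          exact σ.lt_iff_lt.2 hlt
      · right
        refine ⟨by rw [hw, hw'], ?_⟩
        have hK : K ⊆ y.ext := Finset.sdiff_subset
        -- Removing `K` from both sides leaves the images under `σ` of `z.ext` and `x.ext`.
        rw [← Finset.Colex.toColex_sdiff_lt_toColex_sdiff Finset.subset_union_left hK,
          Finset.union_sdiff_cancel_left hd, Finset.sdiff_sdiff_eq_self hI,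
          Finset.Colex.toColex_image_lt_toColex_image σ.strictMono]
        exact hlt
    have hset : (K.toList ++ z.ext.toList.map σ).toFinset = K ∪ z.ext.image σ := by
      ext i; simp
    have hmem : monomial k (MonoIndex.mk (K ∪ z.ext.image σ) fun t => σ (z.word t)) ∈
        Submodule.span k (monomial k '' Set.Iio y) := Submodule.subset_span ⟨_, hlt, rfl⟩
    rcases wedgeWord_of_toFinset (k := k) (nodup_append_map_of_disjoint σ hd) hset with h | h
    · rw [h]; exact hmem
    · rw [h, TensorProduct.neg_tmul]; exact neg_mem hmem
  · rw [wedgeWord_of_not_nodup, TensorProduct.zero_tmul]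
    · exact zero_mem _
    · intro hn
      refine hd (Finset.disjoint_left.2 fun a ha hb => ?_)
      exact (List.nodup_append'.1 hn).2.2 (Finset.mem_toList.2 ha) (by simpa using hb)

/-- The encoding of a monomial as a word that records, at each position, membership in the exterior
part and the tensor factors in which the position occurs. -/
def MonoIndex.encode {n : ℕ} (x : MonoIndex n) : List (Prop × Set (Fin n)) :=
  (List.range (x.ext.sup id + Finset.univ.sup x.word + 1)).map fun i =>
    (i ∈ x.ext, {t | x.word t = i})

/-- Higman's lemma for words over a finite alphabet. An embedding of encodings is a strictly
increasing map of positions that preserves membership in the exterior part and keeps the tensor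
labels, which is a divisibility. -/
theorem wellQuasiOrdered_divides (n : ℕ) : WellQuasiOrdered (Divides (n := n)) := by
  let r : Prop × Set (Fin n) → Prop × Set (Fin n) → Prop := fun a b => (a.1 → b.1) ∧ a.2 = b.2
  have : IsPreorder _ r :=
    { refl := fun a => ⟨id, rfl⟩
      trans := fun a b c h h' => ⟨h'.1 ∘ h.1, h.2.trans h'.2⟩ }
  have hr : (Set.univ : Set (Prop × Set (Fin n))).PartiallyWellOrderedOn r :=
    Set.finite_univ.partiallyWellOrderedOn
  have hH := hr.partiallyWellOrderedOn_sublistForall₂ r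
  intro f
  obtain ⟨i, j, hij, h⟩ := hH.exists_lt (f := fun i => (f i).encode) fun _ _ _ => trivial
  refine ⟨i, j, hij, ?_⟩
  obtain ⟨l, hl, hsub⟩ := List.sublistForall₂_iff.1 h
  obtain ⟨σ, hσ⟩ := List.sublist_iff_exists_orderEmbedding_getElem?_eq.1 hsub
  -- The bound is the length of the encoding and exceeds every index occurring in the monomial.
  have key : ∀ a, a < (f i).ext.sup id + Finset.univ.sup (f i).word + 1 →
      (a ∈ (f i).ext → σ a ∈ (f j).ext) ∧ {t | (f i).word t = a} = {t | (f j).word t = σ a} := by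
    intro a ha
    have hlen : a < ((f i).encode).length := by simpa [MonoIndex.encode] using ha
    have hlen' : a < l.length := hl.length_eq ▸ hlen
    have h1 := (List.forall₂_iff_get.1 hl).2 a hlen hlen'
    have h2 := hσ a
    rw [List.getElem?_eq_getElem hlen'] at h2
    have h3 := List.getElem?_eq_some_iff.1 h2.symm
    obtain ⟨h4, h5⟩ := h3
    simp only [List.get_eq_getElem, ← h5] at h1
    simpa [MonoIndex.encode, r] using h1
  refine ⟨σ, ?_, fun t => ?_⟩
  · intro b hb
    obtain ⟨a, ha, rfl⟩ := Finset.mem_image.1 hb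
    refine (key a ?_).1 ha
    have : a ≤ (f i).ext.sup id := Finset.le_sup (f := id) ha
    omega
  · have : (f i).word t ≤ Finset.univ.sup (f i).word := Finset.le_sup (Finset.mem_univ t)
    have hs := (key ((f i).word t) (by omega)).2
    have : t ∈ {t' | (f i).word t' = (f i).word t} := rfl
    rw [hs] at this
    exact this.symm

/-- The Gröbner lemma is applied over `k`, with multiplication by `R` absorbed into the operators `m
↦ a • σ m`. -/
theorem isIncFG_of_isIncStable {n : ℕ} {N : Submodule (R k) (P k n)} (hN : IsIncStable N) :
    IsIncFG N := by
  let 𝒯 : Set (P k n →ₗ[k] P k n) :=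
    {T | ∃ (a : R k) (σ : ℕ ↪o ℕ), ∀ m, T m = a • incAct k n σ m}
  obtain ⟨s, hsN, hs⟩ := exists_finset_le_span_of_wellQuasiOrdered (monomial k (n := n))
    (span_monomial n) (wellQuasiOrdered_divides n) 𝒯
    (fun x y h => by
      obtain ⟨a, σ, c, hc, h1, h2⟩ := exists_operator_of_divides (k := k) h
      exact ⟨Module.toModuleEnd k (P k n) a ∘ₗ incAct k n σ, ⟨a, σ, fun _ => rfl⟩, c, hc, h1, h2⟩)
    (N.restrictScalars k) (by
      rintro T ⟨a, σ, hT⟩ w hw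
      rw [hT]
      exact N.smul_mem a (hN σ w hw))
  refine ⟨s, le_antisymm ?_ fun m hm => ?_⟩
  · rw [Submodule.span_le]
    rintro _ ⟨σ, m, hm, rfl⟩
    exact hN σ m (hsN hm)
  · have := hs (show m ∈ N.restrictScalars k from hm)
    refine (Submodule.span_le (p := (Submodule.span (R k) {x : P k n | ∃ (σ : ℕ ↪o ℕ), ∃ m ∈ s,
      x = incAct k n σ m}).restrictScalars k)).2 ?_ this
    rintro _ ⟨T, ⟨a, σ, hT⟩, m, hm, rfl⟩
    rw [hT]
    exact Submodule.smul_mem _ a (Submodule.subset_span ⟨σ, m, hm, rfl⟩)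

/-! ### Polynomial representations, elementwise -/

section OrbitMap

variable {k G U M J : Type*} [Field k] [Monoid G] [AddCommMonoid U] [Module k U]
  [AddCommMonoid M] [Module k M]

/-- The map from a free module over the group algebra that sends the basis to the given family. -/
def orbitMap (ρ : Representation k G M) (x : J → M) : (J →₀ MonoidAlgebra k G) →ₗ[k] M :=
  Finsupp.lsum k fun j => LinearMap.applyₗ (x j) ∘ₗ ρ.asAlgebraHom.toLinearMap

theorem orbitMap_single (ρ : Representation k G M) (x : J → M) (j : J) (a : MonoidAlgebra k G) :
    orbitMap ρ x (Finsupp.single j a) = ρ.asAlgebraHom a (x j) := by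
  simp [orbitMap]

theorem orbitMap_apply (ρ : Representation k G M) (x : J → M) (c : J →₀ MonoidAlgebra k G) :
    orbitMap ρ x c = c.sum fun j a => ρ.asAlgebraHom a (x j) := by
  simp [orbitMap, Function.comp_def]

/-- Left translation on a free module over the group algebra. -/
def translate (k : Type*) {G : Type*} (J : Type*) [Field k] [Monoid G] (g : G) :
    (J →₀ MonoidAlgebra k G) →ₗ[k] (J →₀ MonoidAlgebra k G) :=
  Finsupp.mapRange.linearMap (LinearMap.mulLeft k (MonoidAlgebra.of k G g))

theorem orbitMap_translate (ρ : Representation k G M) (x : J → M) (g : G)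
    (c : J →₀ MonoidAlgebra k G) : orbitMap ρ x (translate k J g c) = ρ g (orbitMap ρ x c) := by
  induction c using Finsupp.induction_linear with
  | zero => simp
  | add c d hc hd => simp only [map_add, hc, hd]
  | single j a =>
    rw [translate, Finsupp.mapRange.linearMap_apply, Finsupp.mapRange_single, orbitMap_single,
      orbitMap_single, LinearMap.mulLeft_apply, map_mul, Representation.asAlgebraHom_of]
    rfl

/-- A family whose relations over the group algebra include those of a family in `U` is the image
of elements of a subrepresentation of `U`. -/
theorem exists_intertwiningMap_of_relations {N : Type*} [AddCommGroup N] [Module k N]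
    (ρU : Representation k G U) (ρN : Representation k G N)
    (y : J → U) (x : J → N) (h : ∀ c, orbitMap ρU y c = 0 → orbitMap ρN x c = 0) :
    ∃ (S : Subrepresentation ρU) (f : Representation.IntertwiningMap S.toRepresentation ρN),
      ∀ j, ∃ s, f s = x j := by
  let φ := orbitMap ρU y
  let ψ := orbitMap ρN x
  -- `U` carries no subtraction, so `-c'` is added in the free module before `φ` is applied.
  have hwell : ∀ c c', φ c = φ c' → ψ c = ψ c' := by
    intro c c' hc
    rw [← sub_eq_zero, ← map_sub]
    refine h _ ?_
    rw [sub_eq_add_neg]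
    change φ (c + -c') = 0
    rw [map_add, hc, ← map_add, add_neg_cancel, map_zero]
  let S : Subrepresentation ρU :=
    { toSubmodule := LinearMap.range φ
      apply_mem_toSubmodule := by
        rintro g _ ⟨c, rfl⟩
        exact ⟨translate k J g c, orbitMap_translate ρU y g c⟩ }
  -- By `hwell` the value `ψ (r v)` does not depend on the chosen preimage, which gives linearity
  -- and equivariance.
  choose r hr using fun v : LinearMap.range φ => v.2
  have hf : ∀ c, ψ (r ⟨φ c, c, rfl⟩) = ψ c := fun c => hwell _ _ (hr ⟨φ c, c, rfl⟩)
  let f : LinearMap.range φ →ₗ[k] N :=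
    { toFun := fun v => ψ (r v)
      map_add' := fun v w => by
        rw [← map_add]
        refine hwell _ _ ?_
        rw [map_add, hr, hr, hr]
        rfl
      map_smul' := fun a v => by
        rw [RingHom.id_apply, ← map_smul]
        refine hwell _ _ ?_
        rw [map_smul, hr, hr]
        rfl }
  have hfg : ∀ (g : G) (v : LinearMap.range φ), f (S.toRepresentation g v) = ρN g (f v) := by
    intro g v
    refine Eq.trans (hwell _ (translate k J g (r v)) ?_) (orbitMap_translate ρN x g (r v))
    rw [hr]
    refine Eq.trans ?_ (orbitMap_translate ρU y g (r v)).symm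
    exact congrArg (ρU g) (hr v).symm
  refine ⟨S, ⟨f, fun g => LinearMap.ext fun v => hfg g v⟩, fun j => ?_⟩
  refine ⟨⟨φ (Finsupp.single j 1), _, rfl⟩, (hf (Finsupp.single j 1)).trans ?_⟩
  simp [ψ, orbitMap_single]

end OrbitMap

/-- An element is polynomial if all relations over the group algebra that are common to some
finite list of tensors hold for it. -/
def IsPolynomialElement {M : Type*} [AddCommGroup M] [Module k M]
    (ρ : Representation k (GLinf k) M) (m : M) : Prop :=
  ∃ l : List (Σ d : ℕ, ⨂[k]^d (V k)), ∀ a : MonoidAlgebra k (GLinf k),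
    (∀ t ∈ l, (tensorRep k t.1).asAlgebraHom a t.2 = 0) → ρ.asAlgebraHom a m = 0

theorem directSum_asAlgebraHom_apply {ι : Type*} (d : ι → ℕ) (a : MonoidAlgebra k (GLinf k))
    (x : DirectSum ι fun i => ⨂[k]^(d i) (V k)) (i : ι) :
    (Representation.directSum fun i => tensorRep k (d i)).asAlgebraHom a x i =
      (tensorRep k (d i)).asAlgebraHom a (x i) := by
  induction a using MonoidAlgebra.induction_linear with
  | zero => simp
  | add a b ha hb => simp [ha, hb]
  | single g r =>
    rw [Representation.asAlgebraHom_single, Representation.asAlgebraHom_single]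
    simp only [LinearMap.smul_apply]
    rfl

theorem intertwiningMap_asAlgebraHom {G U W : Type*} [Monoid G] [AddCommMonoid U] [Module k U]
    [AddCommMonoid W] [Module k W] {ρ : Representation k G U} {σ : Representation k G W}
    (f : Representation.IntertwiningMap ρ σ) (a : MonoidAlgebra k G) (x : U) :
    f (ρ.asAlgebraHom a x) = σ.asAlgebraHom a (f x) := by
  induction a using MonoidAlgebra.induction_linear with
  | zero => simp
  | add a b ha hb => simp [ha, hb]
  | single g r =>
    simp [Representation.asAlgebraHom_single, f.isIntertwining]

/-- The relations of a list of tensors are those of one element of their direct sum. -/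
theorem exists_directSum_of_list (l : List (Σ d : ℕ, ⨂[k]^d (V k))) :
    ∃ y : DirectSum (Fin l.length) fun i => ⨂[k]^(l.get i).1 (V k), ∀ i, y i = (l.get i).2 :=
  ⟨DFinsupp.equivFunOnFintype.symm fun i => (l.get i).2, fun _ => rfl⟩

/-- A lift of `m` to the direct sum has finitely many nonzero components; these form the list. -/
theorem IsPolynomial.isPolynomialElement {M : Type u} [AddCommGroup M] [Module k M]
    {ρ : Representation k (GLinf k) M} (h : IsPolynomial ρ) (m : M) :
    IsPolynomialElement ρ m := by
  classical
  obtain ⟨ι, d, S, f, hf⟩ := h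
  obtain ⟨s, rfl⟩ := hf m
  refine ⟨(DFinsupp.support s.1).toList.map fun i => ⟨d i, s.1 i⟩, fun a ha => ?_⟩
  rw [← intertwiningMap_asAlgebraHom]
  have hsub : S.toRepresentation.asAlgebraHom a s = 0 := by
    have hval : (S.toRepresentation.asAlgebraHom a s).1 =
        (Representation.directSum fun i => tensorRep k (d i)).asAlgebraHom a s.1 :=
      intertwiningMap_asAlgebraHom
        (f := (⟨S.toSubmodule.subtype, fun g => rfl⟩ : Representation.IntertwiningMap
          S.toRepresentation (Representation.directSum fun i => tensorRep k (d i)))) a s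
    apply Subtype.ext
    rw [hval]
    refine DFinsupp.ext fun i => ?_
    rw [directSum_asAlgebraHom_apply]
    by_cases hi : i ∈ DFinsupp.support s.1
    · exact ha ⟨d i, s.1 i⟩ (List.mem_map.2 ⟨i, Finset.mem_toList.2 hi, rfl⟩)
    · rw [DFinsupp.notMem_support_iff.1 hi, map_zero]
      rfl
  rw [hsub, map_zero]

/-- The direct sum has a separate block for each `m`, holding the tensors of its list. A relation
among the vectors `y m` therefore splits into one relation for each `m`, and the subrepresentation
they generate maps onto `M`. -/
theorem isPolynomial_of_forall {M : Type u} [AddCommGroup M] [Module k M]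
    {ρ : Representation k (GLinf k) M} (h : ∀ m, IsPolynomialElement ρ m) : IsPolynomial ρ := by
  classical
  choose l hl using h
  let ι := Σ m : M, Fin (l m).length
  let d : ι → ℕ := fun i => ((l i.1).get i.2).1
  let y : M → DirectSum ι fun i => ⨂[k]^(d i) (V k) := fun m =>
    ∑ i : Fin (l m).length, DirectSum.of (fun i : ι => ⨂[k]^(d i) (V k)) ⟨m, i⟩ ((l m).get i).2
  have hy : ∀ m i, y m ⟨m, i⟩ = ((l m).get i).2 := by
    intro m i
    simp only [y, DirectSum.sum_apply]
    rw [Finset.sum_eq_single i]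
    · exact DirectSum.of_eq_same _ _
    · intro j _ hj
      exact DirectSum.of_eq_of_ne _ _ _ fun h => hj (eq_of_heq (Sigma.mk.inj h).2).symm
    · simp
  have hy' : ∀ m m' i, m ≠ m' → y m' ⟨m, i⟩ = 0 := by
    intro m m' i hm
    simp only [y, DirectSum.sum_apply]
    refine Finset.sum_eq_zero fun j _ => DirectSum.of_eq_of_ne _ _ _ ?_
    intro h
    exact hm (congrArg Sigma.fst h)
  obtain ⟨S, f, hf⟩ := exists_intertwiningMap_of_relations
    (Representation.directSum fun i => tensorRep k (d i)) ρ y id (by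
      intro c hc
      rw [orbitMap_apply]
      refine Finset.sum_eq_zero fun m _ => hl m (c m) ?_
      intro t ht
      obtain ⟨i, rfl⟩ := List.mem_iff_get.1 ht
      have h0 : orbitMap (Representation.directSum fun i => tensorRep k (d i)) y c ⟨m, i⟩ = 0 := by
        rw [hc]; rfl
      rw [orbitMap_apply, Finsupp.sum, DirectSum.sum_apply, Finset.sum_eq_single m] at h0
      · rw [directSum_asAlgebraHom_apply, hy] at h0
        exact h0
      · intro m' _ hm'
        rw [directSum_asAlgebraHom_apply, hy' _ _ _ hm'.symm, map_zero]
      · intro hm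
        rw [Finsupp.notMem_support_iff.1 hm, map_zero]
        rfl)
  exact ⟨ι, d, S, f, hf⟩

/-! ### Modules over the skew group ring -/

theorem actR_one : actR (1 : GLinf k) = AlgHom.id k (R k) := ExteriorAlgebra.map_id

theorem actR_mul (g h : GLinf k) : actR (g * h) = (actR g).comp (actR h) :=
  (ExteriorAlgebra.map_comp_map _ _).symm

instance : MulSemiringAction (GLinf k) (R k) where
  smul g a := actR g a
  one_smul a := by change actR 1 a = a; rw [actR_one]; rfl
  mul_smul g h a := by change actR (g * h) a = actR g (actR h a); rw [actR_mul]; rfl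
  smul_zero g := map_zero (actR g)
  smul_add g := map_add (actR g)
  smul_one g := map_one (actR g)
  smul_mul g := map_mul (actR g)

theorem smul_eq_actR (g : GLinf k) (a : R k) : g • a = actR g a := rfl

/-- The skew group ring of `GL` over `R`. -/
abbrev SkewRing (k : Type u) [Field k] : Type u := SkewMonoidAlgebra (R k) (GLinf k)

section SkewHom

variable {M : Type*} [AddCommGroup M] [Module k M] [Module (R k) M] [IsScalarTower k (R k) M]

/-- The action of the skew group ring on an `R`-module with a compatible action of `GL`. -/
def skewHom (ρ : Representation k (GLinf k) M)
    (h : ∀ (g : GLinf k) (a : R k) (m : M), ρ g (a • m) = actR g a • ρ g m) :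
    SkewRing k →+* Module.End k M :=
  SkewMonoidAlgebra.liftNCRingHom (Module.toModuleEnd k M) ρ
    fun {a g} => LinearMap.ext fun m => (h g a m).symm

theorem skewHom_single (ρ : Representation k (GLinf k) M)
    (h : ∀ (g : GLinf k) (a : R k) (m : M), ρ g (a • m) = actR g a • ρ g m)
    (g : GLinf k) (a : R k) (m : M) :
    skewHom ρ h (SkewMonoidAlgebra.single g a) m = a • ρ g m := by
  have : skewHom ρ h (SkewMonoidAlgebra.single g a) = Module.toModuleEnd k M a * ρ g :=
    SkewMonoidAlgebra.liftNC_single _ _ _ _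
  rw [this]
  rfl

end SkewHom

theorem actR_algebraMap (g : GLinf k) (c : k) :
    actR g (algebraMap k (R k) c) = algebraMap k (R k) c := (actR g).commutes c

/-- The embedding of the group algebra of `GL` into the skew group ring. -/
def groupAlgebraHom (k : Type u) [Field k] : MonoidAlgebra k (GLinf k) →+* SkewRing k :=
  MonoidAlgebra.liftNCRingHom
    { toFun := fun c => SkewMonoidAlgebra.single 1 (algebraMap k (R k) c)
      map_one' := by rw [map_one]; rfl
      map_mul' := fun a b => by rw [SkewMonoidAlgebra.single_mul_single, one_smul, one_mul, map_mul]
      map_zero' := by rw [map_zero, SkewMonoidAlgebra.single_zero]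
      map_add' := fun a b => by rw [map_add, SkewMonoidAlgebra.single_add] }
    { toFun := fun g => SkewMonoidAlgebra.single g 1
      map_one' := rfl
      map_mul' := fun a b => by
        rw [SkewMonoidAlgebra.single_mul_single, smul_one, one_mul] }
    -- Scalars commute with group elements because `GL` acts `k`-linearly on `R`.
    fun c g => by
      change SkewMonoidAlgebra.single 1 (algebraMap k (R k) c) * SkewMonoidAlgebra.single g 1 =
        SkewMonoidAlgebra.single g 1 * SkewMonoidAlgebra.single 1 (algebraMap k (R k) c)
      rw [SkewMonoidAlgebra.single_mul_single, SkewMonoidAlgebra.single_mul_single, smul_eq_actR,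
        smul_eq_actR, actR_algebraMap, map_one]
      simp

theorem groupAlgebraHom_single (g : GLinf k) (c : k) :
    groupAlgebraHom k (MonoidAlgebra.single g c) =
      SkewMonoidAlgebra.single g (algebraMap k (R k) c) := by
  have : groupAlgebraHom k (MonoidAlgebra.single g c) =
      SkewMonoidAlgebra.single 1 (algebraMap k (R k) c) * SkewMonoidAlgebra.single g 1 :=
    MonoidAlgebra.liftNC_single _ _ _ _
  rw [this, SkewMonoidAlgebra.single_mul_single, one_smul, one_mul, mul_one]

theorem skewHom_groupAlgebraHom {M : Type*} [AddCommGroup M] [Module k M] [Module (R k) M]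
    [IsScalarTower k (R k) M] (ρ : Representation k (GLinf k) M)
    (h : ∀ (g : GLinf k) (a : R k) (m : M), ρ g (a • m) = actR g a • ρ g m)
    (a : MonoidAlgebra k (GLinf k)) (m : M) :
    skewHom ρ h (groupAlgebraHom k a) m = ρ.asAlgebraHom a m := by
  induction a using MonoidAlgebra.induction_linear with
  | zero => simp
  | add a b ha hb => simp only [map_add, LinearMap.add_apply, ha, hb]
  | single g c =>
    rw [groupAlgebraHom_single, skewHom_single, Representation.asAlgebraHom_single,
      algebraMap_smul]
    rfl

/-- An additive map that commutes with the elements `a g` of the skew group ring is linear. -/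
def skewLinearMap {M N : Type*} [AddCommGroup M] [AddCommGroup N] [Module (SkewRing k) M]
    [Module (SkewRing k) N] (f : M →+ N)
    (h : ∀ (g : GLinf k) (a : R k) (m : M), f ((SkewMonoidAlgebra.single g a : SkewRing k) • m) =
      (SkewMonoidAlgebra.single g a : SkewRing k) • f m) : M →ₗ[SkewRing k] N where
  __ := f
  map_smul' b m := by
    change f (b • m) = b • f m
    induction b using SkewMonoidAlgebra.induction_on with
    | zero => simp
    | single g a => exact h g a m
    | add b c hb hc => rw [add_smul, add_smul, map_add, hb, hc]

/-- An additive subgroup stable under the elements `a g` of the skew group ring is a submodule. -/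
def skewSubmodule {M : Type*} [AddCommGroup M] [Module (SkewRing k) M] (N : AddSubgroup M)
    (h : ∀ (g : GLinf k) (a : R k), ∀ m ∈ N, (SkewMonoidAlgebra.single g a : SkewRing k) • m ∈ N) :
    Submodule (SkewRing k) M where
  __ := N
  smul_mem' b m hm := by
    change b • m ∈ N
    induction b using SkewMonoidAlgebra.induction_on with
    | zero => rw [zero_smul]; exact N.zero_mem
    | single g a => exact h g a m hm
    | add b c hb hc => rw [add_smul]; exact N.add_mem hb hc

namespace ModR

instance (M : ModR k) : Module (SkewRing k) M := Module.compHom M (skewHom M.ρ M.ρ_smul)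

theorem single_smul (M : ModR k) (g : GLinf k) (a : R k) (m : M) :
    (SkewMonoidAlgebra.single g a : SkewRing k) • m = a • M.ρ g m :=
  skewHom_single M.ρ M.ρ_smul g a m

theorem groupAlgebraHom_smul (M : ModR k) (a : MonoidAlgebra k (GLinf k)) (m : M) :
    groupAlgebraHom k a • m = M.ρ.asAlgebraHom a m :=
  skewHom_groupAlgebraHom M.ρ M.ρ_smul a m

/-- A stable `R`-submodule as a submodule over the skew group ring. -/
def stableSubmodule (M : ModR k) (N : Submodule (R k) M) (hN : M.IsStable N) :
    Submodule (SkewRing k) M :=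
  skewSubmodule N.toAddSubgroup fun g a m hm => by
    rw [single_smul]
    exact N.smul_mem a (hN g m hm)

theorem isStable_span_orbits (M : ModR k) (s : Finset M) :
    M.IsStable (Submodule.span (R k) {x : M | ∃ (g : GLinf k), ∃ m ∈ s, x = M.ρ g m}) := by
  intro g m hm
  induction hm using Submodule.span_induction with
  | mem x hx =>
    obtain ⟨h, m, hm, rfl⟩ := hx
    exact Submodule.subset_span ⟨g * h, m, hm, by rw [map_mul]; rfl⟩
  | zero => rw [map_zero]; exact zero_mem _
  | add x y _ _ hx hy => rw [map_add]; exact add_mem hx hy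
  | smul a x _ hx => rw [M.ρ_smul]; exact Submodule.smul_mem _ _ hx

theorem span_skewRing_le_span_orbits (M : ModR k) (s : Finset M) {m : M}
    (hm : m ∈ Submodule.span (SkewRing k) (s : Set M)) :
    m ∈ Submodule.span (R k) {x : M | ∃ (g : GLinf k), ∃ m ∈ s, x = M.ρ g m} := by
  have : Submodule.span (SkewRing k) (s : Set M) ≤
      M.stableSubmodule _ (M.isStable_span_orbits s) := by
    rw [Submodule.span_le]
    intro x hx
    exact Submodule.subset_span (R := R k) ⟨1, x, hx, by rw [map_one]; rfl⟩
  exact this hm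

theorem span_orbits_le_span_skewRing (M : ModR k) (s : Finset M) {m : M}
    (hm : m ∈ Submodule.span (R k) {x : M | ∃ (g : GLinf k), ∃ m ∈ s, x = M.ρ g m}) :
    m ∈ Submodule.span (SkewRing k) (s : Set M) := by
  induction hm using Submodule.span_induction with
  | mem x hx =>
    obtain ⟨h, m, hm, rfl⟩ := hx
    have := Submodule.smul_mem (Submodule.span (SkewRing k) (s : Set M))
      (SkewMonoidAlgebra.single h 1) (Submodule.subset_span hm)
    rwa [single_smul, one_smul] at this
  | zero => exact zero_mem _
  | add x y _ _ hx hy => exact add_mem hx hy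
  | smul a x _ hx =>
    have := Submodule.smul_mem _ (SkewMonoidAlgebra.single (1 : GLinf k) a) hx
    rwa [single_smul, map_one] at this

/-- Stable `R`-submodules are submodules over the skew group ring, and the `R`-span of the orbits of
a finite set is its span over that ring. -/
theorem isFG_of_isNoetherian (M : ModR k) [IsNoetherian (SkewRing k) M] (N : Submodule (R k) M)
    (hN : M.IsStable N) : M.IsFG N := by
  obtain ⟨s, hs⟩ := IsNoetherian.noetherian (M.stableSubmodule N hN)
  refine ⟨s, le_antisymm (fun m hm => ?_) fun m hm => ?_⟩
  · have := M.span_orbits_le_span_skewRing s hm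
    rw [hs] at this
    exact this
  · apply M.span_skewRing_le_span_orbits s
    rw [hs]
    exact hm

end ModR

/-! ### Induced modules -/

section Induced

variable {W W' : Type u} [AddCommMonoid W] [Module k W] [AddCommMonoid W'] [Module k W']

/-- The `R`-module `R ⊗ W` induced from a representation `W` of `GL`. -/
def Induced (_ : Representation k (GLinf k) W) : Type u := R k ⊗[k] W

instance (τ : Representation k (GLinf k) W) : AddCommGroup (Induced τ) :=
  inferInstanceAs (AddCommGroup (R k ⊗[k] W))

/-- The diagonal action of `GL` on `R ⊗ W`. -/
def diagonalRep (τ : Representation k (GLinf k) W) : Representation k (GLinf k) (R k ⊗[k] W) where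
  toFun g := TensorProduct.map (actR g).toLinearMap (τ g)
  map_one' := by
    refine TensorProduct.ext' fun a w => ?_
    simp [actR_one]
  map_mul' g h := by
    refine TensorProduct.ext' fun a w => ?_
    simp [actR_mul]

theorem diagonalRep_tmul (τ : Representation k (GLinf k) W) (g : GLinf k) (a : R k) (w : W) :
    diagonalRep τ g (a ⊗ₜ w) = actR g a ⊗ₜ τ g w := rfl

theorem diagonalRep_smul (τ : Representation k (GLinf k) W) (g : GLinf k) (a : R k)
    (x : R k ⊗[k] W) : diagonalRep τ g (a • x) = actR g a • diagonalRep τ g x := by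
  induction x using TensorProduct.induction_on with
  | zero => simp
  | add x y hx hy => simp only [smul_add, map_add, hx, hy]
  | tmul b w =>
    simp only [TensorProduct.smul_tmul', diagonalRep_tmul, smul_eq_mul, map_mul]

instance (τ : Representation k (GLinf k) W) : Module (SkewRing k) (Induced τ) :=
  letI : Module (Module.End k (R k ⊗[k] W)) (Induced τ) :=
    inferInstanceAs (Module (Module.End k (R k ⊗[k] W)) (R k ⊗[k] W))
  Module.compHom (Induced τ) (skewHom (diagonalRep τ) (diagonalRep_smul τ))

theorem Induced.single_smul (τ : Representation k (GLinf k) W) (g : GLinf k) (a : R k)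
    (x : R k ⊗[k] W) : (SkewMonoidAlgebra.single g a : SkewRing k) • (show Induced τ from x) =
      (show Induced τ from a • diagonalRep τ g x) :=
  skewHom_single (diagonalRep τ) (diagonalRep_smul τ) g a x

/-- The map of induced modules given by an equivariant map. -/
def Induced.map {τ : Representation k (GLinf k) W} {τ' : Representation k (GLinf k) W'}
    (f : W →ₗ[k] W') (hf : ∀ g w, f (τ g w) = τ' g (f w)) : Induced τ →ₗ[SkewRing k] Induced τ' :=
  skewLinearMap (LinearMap.lTensor (R k) f).toAddMonoidHom fun g a x => by
    refine (congrArg (LinearMap.lTensor (R k) f) (Induced.single_smul τ g a x)).trans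
      (Eq.trans ?_ (Induced.single_smul τ' g a (LinearMap.lTensor (R k) f x)).symm)
    change LinearMap.lTensor (R k) f (a • diagonalRep τ g x) =
      a • diagonalRep τ' g (LinearMap.lTensor (R k) f x)
    induction x using TensorProduct.induction_on with
    | zero => simp
    | add x y hx hy => simp only [map_add, smul_add, hx, hy]
    | tmul b w =>
      simp only [diagonalRep_tmul, TensorProduct.smul_tmul', LinearMap.lTensor_tmul, hf]

/-- `R` is flat over the field `k`. -/
theorem Induced.map_injective {τ : Representation k (GLinf k) W}
    {τ' : Representation k (GLinf k) W'} (f : W →ₗ[k] W') (hf : ∀ g w, f (τ g w) = τ' g (f w))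
    (h : Function.Injective f) : Function.Injective (Induced.map f hf) :=
  Module.Flat.lTensor_preserves_injective_linearMap (M := R k) f h

/-- The map from an induced module given by an equivariant map to an object of `Mod_R`. -/
def Induced.desc {τ : Representation k (GLinf k) W} {M : ModR k}
    (f : W →ₗ[k] M) (hf : ∀ g w, f (τ g w) = M.ρ g (f w)) : Induced τ →ₗ[SkewRing k] M :=
  let F : R k ⊗[k] W →ₗ[k] M := TensorProduct.lift
    (LinearMap.mk₂ k (fun (a : R k) (w : W) => a • f w)
      (fun a b w => add_smul a b (f w)) (fun c a w => smul_assoc c a (f w))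
      (fun a w w' => by rw [map_add, smul_add]) (fun c a w => by rw [map_smul, smul_comm]))
  have hF : ∀ (a : R k) (w : W), F (a ⊗ₜ w) = a • f w := fun a w => rfl
  skewLinearMap F.toAddMonoidHom fun g a x => by
    rw [ModR.single_smul]
    refine (congrArg F (Induced.single_smul τ g a x)).trans ?_
    change F (a • diagonalRep τ g x) = a • M.ρ g (F x)
    induction x using TensorProduct.induction_on with
    | zero => simp
    | add x y hx hy => simp only [map_add, smul_add, hx, hy]
    | tmul b w =>
      rw [diagonalRep_tmul, TensorProduct.smul_tmul', hF, hF, hf, M.ρ_smul, smul_eq_mul, mul_smul]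

theorem Induced.desc_one_tmul {τ : Representation k (GLinf k) W} {M : ModR k}
    (f : W →ₗ[k] M) (hf : ∀ g w, f (τ g w) = M.ρ g (f w)) (w : W) :
    Induced.desc f hf (show Induced τ from 1 ⊗ₜ w) = f w :=
  one_smul (R k) (f w)

end Induced

/-! ### Noetherianity -/

/-- The symmetric group of `Fin n` is `b`-transitive. The choice `n = b + σ b` makes room for both
the indices below `b` and their images. -/
theorem exists_perm_eqOn_lt (σ : ℕ ↪o ℕ) (b : ℕ) :
    ∃ π : Equiv.Perm ℕ, (∀ i < b, π i = σ i) ∧ ∃ n, ∀ i, n ≤ i → π i = i := by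
  classical
  set n := b + σ b
  have hlt : ∀ i : Fin b, σ i < n := fun i => (σ.strictMono i.2).trans_le (Nat.le_add_left _ _)
  let x : Fin b ↪ Fin n := Fin.castLEEmb (Nat.le_add_right _ _)
  let y : Fin b ↪ Fin n := ⟨fun i => ⟨σ i, hlt i⟩, fun i j h => by
    simpa [Fin.ext_iff] using h⟩
  have := Equiv.Perm.isMultiplyPretransitive (Fin n) b
  obtain ⟨e, he⟩ := MulAction.exists_smul_eq (Equiv.Perm (Fin n)) x y
  refine ⟨e.viaFintypeEmbedding Fin.valEmbedding, fun i hi => ?_, n, fun i hi => ?_⟩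
  · have h1 := e.viaFintypeEmbedding_apply_image Fin.valEmbedding (x ⟨i, hi⟩)
    have h2 : e (x ⟨i, hi⟩) = y ⟨i, hi⟩ := DFunLike.congr_fun he ⟨i, hi⟩
    rw [h2] at h1
    exact h1
  · refine e.viaFintypeEmbedding_apply_notMem_range _ ?_
    rintro ⟨j, rfl⟩
    exact absurd j.2 (not_lt.2 hi)

theorem exists_eqOn_basis_lt (k : Type u) [Field k] (σ : ℕ ↪o ℕ) (b : ℕ) :
    ∃ g : GLinf k, ∀ i < b, g.1 (Finsupp.single i 1) = Finsupp.single (σ i) 1 := by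
  obtain ⟨π, hπ, n, hn⟩ := exists_perm_eqOn_lt σ b
  refine ⟨⟨Finsupp.domLCongr π, n, fun i hi => ?_⟩, fun i hi => ?_⟩
  · rw [Finsupp.domLCongr_single, hn i hi]
  · change Finsupp.domLCongr π _ = _
    rw [Finsupp.domLCongr_single, hπ i hi]

theorem actR_wedgeWord (g : GLinf k) (σ : ℕ → ℕ) (l : List ℕ)
    (h : ∀ i ∈ l, g.1 (Finsupp.single i 1) = Finsupp.single (σ i) 1) :
    actR g (wedgeWord k l) = wedgeWord k (l.map σ) := by
  induction l with
  | nil => simp [wedgeWord]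
  | cons i l ih =>
    have ih' := ih fun j hj => h j (List.mem_cons_of_mem _ hj)
    simp only [wedgeWord, List.map_cons, List.prod_cons, map_mul] at ih' ⊢
    rw [ih']
    congr 1
    refine (ExteriorAlgebra.map_apply_ι _ _).trans ?_
    exact congrArg _ (h i List.mem_cons_self)

theorem exists_diagonalRep_eq_incAct {n : ℕ} (σ : ℕ ↪o ℕ) (p : P k n) :
    ∃ g : GLinf k, diagonalRep (tensorRep k n) g p = incAct k n σ p := by
  -- Asking for a bound valid for all such `g` makes the claim additive in `p`: bounds combine by a
  -- maximum, while individual group elements do not.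
  suffices h : ∃ b : ℕ, ∀ g : GLinf k,
      (∀ i < b, g.1 (Finsupp.single i 1) = Finsupp.single (σ i) 1) →
        diagonalRep (tensorRep k n) g p = incAct k n σ p by
    obtain ⟨b, hb⟩ := h
    obtain ⟨g, hg⟩ := exists_eqOn_basis_lt k σ b
    exact ⟨g, hb g hg⟩
  have hp : p ∈ Submodule.span k (Set.range (monomial k (n := n))) := by
    rw [span_monomial]; trivial
  induction hp using Submodule.span_induction with
  | mem x hx =>
    obtain ⟨x, rfl⟩ := hx
    refine ⟨x.ext.sup id + Finset.univ.sup x.word + 1, fun g hg => ?_⟩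
    rw [incAct_monomial, monomial, diagonalRep_tmul, actR_wedgeWord g σ]
    · congr 1
      refine (PiTensorProduct.map_tprod _ _).trans ?_
      refine congrArg _ (funext fun t => hg _ ?_)
      have : x.word t ≤ Finset.univ.sup x.word := Finset.le_sup (Finset.mem_univ t)
      omega
    · intro i hi
      have : i ≤ x.ext.sup id := Finset.le_sup (f := id) (Finset.mem_toList.1 hi)
      exact hg _ (by omega)
  | zero => exact ⟨0, fun g _ => by rw [map_zero, map_zero]⟩
  | add x y _ _ hx hy =>
    obtain ⟨b, hb⟩ := hx
    obtain ⟨c, hc⟩ := hy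
    refine ⟨max b c, fun g hg => ?_⟩
    rw [map_add, map_add, hb g fun i hi => hg i (lt_max_of_lt_left hi),
      hc g fun i hi => hg i (lt_max_of_lt_right hi)]
  | smul a x _ hx =>
    obtain ⟨b, hb⟩ := hx
    exact ⟨b, fun g hg => by rw [map_smul, map_smul, hb g hg]⟩

/-- Stability under `GL` implies stability under `Inc(ℕ)`, and each `σ m` is some `g m`, so finitely
many `Inc(ℕ)`-generators also generate over the skew group ring. -/
theorem isNoetherian_induced_tensorRep (k : Type u) [Field k] (n : ℕ) :
    IsNoetherian (SkewRing k) (Induced (tensorRep k n)) := by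
  constructor
  intro N
  let N' : Submodule (R k) (P k n) :=
    { carrier := {p : P k n | (show Induced (tensorRep k n) from p) ∈ N}
      add_mem' := fun hx hy => N.add_mem hx hy
      zero_mem' := N.zero_mem
      smul_mem' := fun a p hp => by
        have := N.smul_mem (SkewMonoidAlgebra.single 1 a) hp
        rw [Induced.single_smul, map_one] at this
        exact this }
  have hstable : ∀ (g : GLinf k) (p : P k n), p ∈ N' → diagonalRep (tensorRep k n) g p ∈ N' := by
    intro g p hp
    have := N.smul_mem (SkewMonoidAlgebra.single g 1) hp
    rw [Induced.single_smul, one_smul] at this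
    exact this
  obtain ⟨s, hs⟩ := isIncFG_of_isIncStable (N := N') fun σ p hp => by
    obtain ⟨g, hg⟩ := exists_diagonalRep_eq_incAct σ p
    rw [← hg]
    exact hstable g p hp
  -- The identity of `Inc(ℕ)` puts each generator in its own orbit.
  have hsN : ∀ p ∈ s, p ∈ N' := by
    intro p hp
    rw [← hs]
    refine Submodule.subset_span ⟨RelEmbedding.refl _, p, hp, ?_⟩
    have : (incAct k n (RelEmbedding.refl _)) = LinearMap.id := by
      have h1 : Finsupp.lmapDomain k k ((RelEmbedding.refl _ : ℕ ↪o ℕ) : ℕ → ℕ) = LinearMap.id := by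
        ext; simp
      have h2 : ∀ x, ExteriorAlgebra.map (LinearMap.id : V k →ₗ[k] V k) x = x := fun x => by simp
      refine TensorProduct.ext' fun a w => ?_
      simp only [incAct, h1, TensorProduct.map_tmul, PiTensorProduct.map_id]
      simp
    rw [this]
    rfl
  let s' : Finset (Induced (tensorRep k n)) := s
  set S : Submodule (SkewRing k) (Induced (tensorRep k n)) := Submodule.span (SkewRing k) s'
  have hS : ∀ (g : GLinf k) (a : R k) (p : P k n), (show Induced (tensorRep k n) from p) ∈ S →
      (show Induced (tensorRep k n) from a • diagonalRep (tensorRep k n) g p) ∈ S := by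
    intro g a p hp
    have := S.smul_mem (SkewMonoidAlgebra.single g a) hp
    rwa [Induced.single_smul] at this
  have key : ∀ p : P k n,
      p ∈ Submodule.span (R k) {x : P k n | ∃ (σ : ℕ ↪o ℕ), ∃ m ∈ s, x = incAct k n σ m} →
        (show Induced (tensorRep k n) from p) ∈ S := by
    intro p hp
    induction hp using Submodule.span_induction with
    | mem x hx =>
      obtain ⟨σ, m, hm, rfl⟩ := hx
      obtain ⟨g, hg⟩ := exists_diagonalRep_eq_incAct σ m
      have := hS g 1 m (Submodule.subset_span hm)
      rwa [one_smul, hg] at this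
    | zero => exact S.zero_mem
    | add x y _ _ hx hy => exact S.add_mem hx hy
    | smul a x _ hx =>
      have := hS 1 a x hx
      rwa [map_one] at this
  refine ⟨s', le_antisymm (Submodule.span_le.2 fun p hp => hsN p hp) fun p hp => key p ?_⟩
  rw [hs]
  exact hp

theorem isNoetherian_induced_directSum {ι : Type} [Finite ι] (d : ι → ℕ) :
    IsNoetherian (SkewRing k) (Induced (Representation.directSum fun i => tensorRep k (d i))) := by
  classical
  set ρ := Representation.directSum fun i => tensorRep k (d i)
  let f : ∀ i, Induced (tensorRep k (d i)) →ₗ[SkewRing k] Induced ρ := fun i =>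
    Induced.map (DirectSum.lof k ι (fun i => ⨂[k]^(d i) (V k)) i) fun g w =>
      (DirectSum.lmap_lof (fun i => tensorRep k (d i) g) i w).symm
  have hN : ∀ i, IsNoetherian (SkewRing k) (LinearMap.range (f i)) := fun i =>
    have := isNoetherian_induced_tensorRep k (d i)
    isNoetherian_of_surjective (f i).rangeRestrict (LinearMap.range_rangeRestrict _)
  have htop : (⨆ i, LinearMap.range (f i)) = ⊤ := by
    refine eq_top_iff.2 fun x _ => ?_
    set S := ⨆ i, LinearMap.range (f i)
    induction x using TensorProduct.induction_on with
    | zero => exact S.zero_mem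
    | add x y hx hy => exact S.add_mem (hx trivial) (hy trivial)
    | tmul a w =>
      induction w using DirectSum.induction_on with
      | zero => rw [TensorProduct.tmul_zero]; exact S.zero_mem
      | of i w => exact Submodule.mem_iSup_of_mem i ⟨a ⊗ₜ w, rfl⟩
      | add x y hx hy => rw [TensorProduct.tmul_add]; exact S.add_mem (hx trivial) (hy trivial)
  have := isNoetherian_iSup (M := fun i => LinearMap.range (f i))
  rw [htop] at this
  exact isNoetherian_top_iff.1 this

namespace ModR

theorem isPolynomialElement (M : ModR k) (m : M) : IsPolynomialElement M.ρ m :=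
  M.polynomial.isPolynomialElement m

/-- The list attached to `m` is a single vector `y` of a finite direct sum, and `m` satisfies the
relations of `y`. So `m` is the image of `1 ⊗ s` under a map from `R ⊗ S`, a submodule of a
noetherian induced module. -/
theorem isNoetherian_span_singleton (M : ModR k) (m : M) :
    IsNoetherian (SkewRing k) (Submodule.span (SkewRing k) {m}) := by
  obtain ⟨l, hl⟩ := M.isPolynomialElement m
  obtain ⟨y, hy⟩ := exists_directSum_of_list l
  obtain ⟨S, f, hf⟩ := exists_intertwiningMap_of_relations
    (Representation.directSum fun i => tensorRep k (l.get i).1) M.ρ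
    (fun _ : Unit => y) (fun _ => m) (by
      intro c hc
      obtain ⟨a, rfl⟩ : ∃ a, c = Finsupp.single () a := ⟨c (), Finsupp.unique_ext (by simp)⟩
      rw [orbitMap_single] at hc ⊢
      refine hl a fun t ht => ?_
      obtain ⟨i, rfl⟩ := List.mem_iff_get.1 ht
      rw [← hy]
      refine (directSum_asAlgebraHom_apply (fun i => (l.get i).1) a y i).symm.trans ?_
      rw [hc]
      rfl)
  obtain ⟨s, hs⟩ := hf ()
  let i : Induced S.toRepresentation →ₗ[SkewRing k]
      Induced (Representation.directSum fun i => tensorRep k (l.get i).1) :=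
    Induced.map S.toSubmodule.subtype fun _ _ => rfl
  have := isNoetherian_induced_directSum (k := k) fun i => (l.get i).1
  have : IsNoetherian (SkewRing k) (Induced S.toRepresentation) :=
    isNoetherian_of_injective i (Induced.map_injective _ _ S.toSubmodule.injective_subtype)
  let q : Induced S.toRepresentation →ₗ[SkewRing k] M :=
    Induced.desc f.toLinearMap fun g w =>
      Representation.IntertwiningMap.isIntertwining _ _ f g w
  have : IsNoetherian (SkewRing k) (LinearMap.range q) :=
    isNoetherian_of_surjective q.rangeRestrict (LinearMap.range_rangeRestrict _)
  refine isNoetherian_of_le (t := LinearMap.range q) ?_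
  rw [Submodule.span_singleton_le_iff_mem]
  exact ⟨_, (Induced.desc_one_tmul _ _ s).trans hs⟩

theorem isNoetherian_of_isFG (M : ModR k) (hM : M.IsFG ⊤) : IsNoetherian (SkewRing k) M := by
  obtain ⟨s, hs⟩ := hM
  have hN : ∀ x : s, IsNoetherian (SkewRing k) (Submodule.span (SkewRing k) {(x : M.carrier)}) :=
    fun x => M.isNoetherian_span_singleton x
  have htop : (⨆ x : s, Submodule.span (SkewRing k) {(x : M.carrier)}) = ⊤ := by
    refine eq_top_iff.2 fun m _ => ?_
    have hm : m ∈ Submodule.span (SkewRing k) (s : Set M) := by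
      apply M.span_orbits_le_span_skewRing s
      rw [hs]
      trivial
    refine Submodule.span_le.2 (fun x hx => ?_) hm
    exact Submodule.mem_iSup_of_mem ⟨x, hx⟩ (Submodule.mem_span_singleton_self x)
  have := isNoetherian_iSup (M := fun x : s => Submodule.span (SkewRing k) {(x : M.carrier)})
  rw [htop] at this
  exact isNoetherian_top_iff.1 this

end ModR

open Limits

/-! ### The category of polynomial modules over the skew group ring -/

/-- A vector in a module over the skew group ring is polynomial if all relations over the group
algebra that are common to some finite list of tensors hold for it. -/
def IsPolynomialVector (k : Type u) [Field k] {X : Type*} [AddCommGroup X] [Module (SkewRing k) X] (x : X) : Prop :=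
  ∃ l : List (Σ d : ℕ, ⨂[k]^d (V k)), ∀ a : MonoidAlgebra k (GLinf k),
    (∀ t ∈ l, (tensorRep k t.1).asAlgebraHom a t.2 = 0) → groupAlgebraHom k a • x = 0

section IsPolynomialVector

variable {X Y : Type*} [AddCommGroup X] [Module (SkewRing k) X] [AddCommGroup Y]
  [Module (SkewRing k) Y]

theorem IsPolynomialVector.map (f : X →ₗ[SkewRing k] Y) {x : X} (hx : IsPolynomialVector k x) :
    IsPolynomialVector k (f x) := by
  obtain ⟨l, hl⟩ := hx
  exact ⟨l, fun a ha => by rw [← map_smul, hl a ha, map_zero]⟩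

theorem IsPolynomialVector.zero : IsPolynomialVector k (0 : X) :=
  ⟨[], fun _ _ => smul_zero _⟩

theorem IsPolynomialVector.add {x y : X} (hx : IsPolynomialVector k x)
    (hy : IsPolynomialVector k y) : IsPolynomialVector k (x + y) := by
  obtain ⟨l, hl⟩ := hx
  obtain ⟨l', hl'⟩ := hy
  refine ⟨l ++ l', fun a ha => ?_⟩
  rw [smul_add, hl a fun t ht => ha t (List.mem_append_left _ ht),
    hl' a fun t ht => ha t (List.mem_append_right _ ht), add_zero]

/-- Concatenating the lists of the images works because the family is finite and jointly injective.
This gives closure under subobjects and finite limits. -/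
theorem isPolynomialVector_of_finite {J : Type*} [Finite J] {Z : J → Type*}
    [∀ j, AddCommGroup (Z j)] [∀ j, Module (SkewRing k) (Z j)] (f : ∀ j, X →ₗ[SkewRing k] Z j)
    (hf : ∀ x, (∀ j, f j x = 0) → x = 0) {x : X} (hx : ∀ j, IsPolynomialVector k (f j x)) :
    IsPolynomialVector k x := by
  cases nonempty_fintype J
  choose l hl using hx
  refine ⟨Finset.univ.toList.flatMap l, fun a ha => hf _ fun j => ?_⟩
  rw [map_smul]
  exact hl j a fun t ht => ha t (List.mem_flatMap.2 ⟨j, by simp, ht⟩)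

end IsPolynomialVector

/-- The modules over the skew group ring all of whose vectors are polynomial. -/
def polynomialModule (k : Type u) [Field k] : ObjectProperty (ModuleCat.{u} (SkewRing k)) :=
  fun X => ∀ x : X, IsPolynomialVector k x

instance : (polynomialModule k).IsClosedUnderSubobjects where
  prop_of_mono {X Y} f hf hY x :=
    isPolynomialVector_of_finite (fun _ : Unit => f.hom)
      (fun x hx => (ModuleCat.mono_iff_injective f).1 hf (by simpa using hx ())) fun _ => hY _

instance : (polynomialModule k).IsClosedUnderQuotients where
  prop_of_epi {X Y} f hf hX y := by
    obtain ⟨x, rfl⟩ := (ModuleCat.epi_iff_surjective f).1 hf y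
    exact (hX x).map f.hom

instance {J : Type*} [Category J] [Finite J] :
    (polynomialModule k).IsClosedUnderLimitsOfShape J where
  limitsOfShape_le := by
    rintro X ⟨h⟩ x
    refine isPolynomialVector_of_finite (fun j => (h.π.app j).hom) (fun x hx => ?_)
      fun j => h.prop_diag_obj j _
    -- Elements of the limit are maps from the free module of rank one, so the projections are
    -- jointly injective.
    have : ModuleCat.ofHom (LinearMap.toSpanSingleton (SkewRing k) X x) = 0 := by
      refine h.isLimit.hom_ext fun j => ?_
      ext
      simpa using hx j
    simpa using congrArg (fun f => f.hom 1) this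

/-- A leg of a cocone of modules, as a linear map. -/
def coconeLeg {A : Type*} [Ring A] {J : Type*} [Category J] {F : J ⥤ ModuleCat.{v} A}
    (c : Cocone F) (j : J) : F.obj j →ₗ[A] c.pt :=
  (c.ι.app j).hom

/-- The projection modulo the sum of the images vanishes on every leg, hence is zero. -/
theorem iSup_range_eq_top_of_isColimit {A : Type*} [Ring A] {J : Type*} [Category J]
    {F : J ⥤ ModuleCat.{v} A} {c : Cocone F} (hc : IsColimit c) :
    ⨆ j, LinearMap.range (coconeLeg c j) = ⊤ := by
  set Q : Submodule A c.pt := ⨆ j, LinearMap.range (coconeLeg c j)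
  have hQ : ModuleCat.ofHom Q.mkQ = 0 := by
    refine hc.hom_ext fun j => ModuleCat.hom_ext (LinearMap.ext fun y => ?_)
    exact (Submodule.Quotient.mk_eq_zero Q).2
      (Submodule.mem_iSup_of_mem (p := fun j => LinearMap.range (coconeLeg c j)) j ⟨y, rfl⟩)
  refine eq_top_iff.2 fun x _ => (Submodule.Quotient.mk_eq_zero Q).1 ?_
  exact congrArg (fun f => f.hom x) hQ

instance {J : Type*} [Category J] : (polynomialModule k).IsClosedUnderColimitsOfShape J where
  colimitsOfShape_le := by
    rintro X ⟨h⟩ x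
    have hx : x ∈ ⨆ j, LinearMap.range (coconeLeg (Cocone.mk X h.ι) j) :=
      (iSup_range_eq_top_of_isColimit h.isColimit).ge trivial
    refine Submodule.iSup_induction _ (motive := fun x => IsPolynomialVector k x) hx ?_ .zero
      fun y z hy hz => hy.add hz
    rintro j _ ⟨z, rfl⟩
    exact (h.prop_diag_obj j z).map (coconeLeg (Cocone.mk X h.ι) j)

instance : (polynomialModule k).ContainsZero where
  exists_zero := ⟨ModuleCat.of _ PUnit, ModuleCat.isZero_of_subsingleton _, fun _ => .zero⟩

instance : (polynomialModule k).IsClosedUnderFiniteProducts where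
  isClosedUnderLimitsOfShape J _ :=
    have : Finite (Discrete J) := Finite.of_equiv J discreteEquiv.symm
    inferInstance

/-- The category of polynomial modules over the skew group ring. -/
abbrev PolyMod (k : Type u) [Field k] := (polynomialModule k).FullSubcategory

instance : PreservesFiniteLimits (polynomialModule k).ι where
  preservesFiniteLimits _ := inferInstance

instance : ReflectsFiniteLimits (polynomialModule k).ι where
  reflects _ := inferInstance

instance : HasColimitsOfSize.{u, u} (PolyMod k) where
  has_colimits_of_shape _ := inferInstance

/-- Exactness of filtered colimits is inherited from modules, since finite limits and colimits are
computed there. -/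
instance : AB5OfSize.{u, u} (PolyMod k) where
  ofShape J := HasExactColimitsOfShape.domain_of_functor J (polynomialModule k).ι

/-! ### Comparison with `Mod_R` -/

/-- The embedding of `R` into the skew group ring. -/
def coeffHom (k : Type u) [Field k] : R k →+* SkewRing k where
  toFun a := SkewMonoidAlgebra.single 1 a
  map_one' := rfl
  map_mul' a b := by rw [SkewMonoidAlgebra.single_mul_single, one_smul, one_mul]
  map_zero' := SkewMonoidAlgebra.single_zero _
  map_add' a b := SkewMonoidAlgebra.single_add _ _ _

theorem coeffHom_mul_single (a : R k) (g : GLinf k) :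
    coeffHom k a * SkewMonoidAlgebra.single g 1 = SkewMonoidAlgebra.single g a := by
  change SkewMonoidAlgebra.single 1 a * _ = _
  rw [SkewMonoidAlgebra.single_mul_single, one_smul, one_mul, mul_one]

theorem single_mul_coeffHom (a : R k) (g : GLinf k) :
    SkewMonoidAlgebra.single g 1 * coeffHom k a = coeffHom k (actR g a) *
      SkewMonoidAlgebra.single g 1 := by
  rw [coeffHom_mul_single]
  change _ * SkewMonoidAlgebra.single 1 a = _
  rw [SkewMonoidAlgebra.single_mul_single, one_mul, mul_one, smul_eq_actR]

namespace ModR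

/-- The functor from `Mod_R` to modules over the skew group ring. -/
def toModuleCat (k : Type u) [Field k] : ModR k ⥤ ModuleCat.{u} (SkewRing k) where
  obj M := ModuleCat.of (SkewRing k) M
  map {M N} f := ModuleCat.ofHom (skewLinearMap f.toLin.toAddMonoidHom fun g a m => by
    rw [single_smul, single_smul]
    exact (map_smul f.toLin a _).trans (congrArg (a • ·) (f.equivariant g m)))

instance : (toModuleCat k).Faithful where
  map_injective {M N} f g h := by
    apply Hom.ext
    ext m
    exact congrArg (fun f => f.hom m) h

instance : (toModuleCat k).Full where
  map_surjective {M N} f := by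
    let φ : M →ₗ[SkewRing k] N := f.hom
    refine ⟨⟨{ toFun := φ, map_add' := map_add φ, map_smul' := fun a m => ?_ },
      fun g m => ?_⟩, rfl⟩
    · have h1 : a • m = (SkewMonoidAlgebra.single 1 a : SkewRing k) • m := by
        rw [M.single_smul, map_one]; rfl
      have h2 : a • φ m = (SkewMonoidAlgebra.single 1 a : SkewRing k) • φ m := by
        rw [N.single_smul, map_one]; rfl
      rw [RingHom.id_apply, h1, h2, map_smul]
    · have h1 : M.ρ g m = (SkewMonoidAlgebra.single g 1 : SkewRing k) • m := by
        rw [M.single_smul, one_smul]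
      have h2 : N.ρ g (φ m) = (SkewMonoidAlgebra.single g 1 : SkewRing k) • φ m := by
        rw [N.single_smul, one_smul]
      change φ _ = N.ρ g (φ m)
      rw [h1, h2, map_smul]

theorem polynomialModule_toModuleCat (M : ModR k) : polynomialModule k ((toModuleCat k).obj M) := by
  intro m
  obtain ⟨l, hl⟩ := M.isPolynomialElement m
  exact ⟨l, fun a ha => (M.groupAlgebraHom_smul a m).trans (hl a ha)⟩

/-- The object of `Mod_R` given by a polynomial module over the skew group ring. -/
def ofModule (X : Type u) [AddCommGroup X] [Module (SkewRing k) X]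
    (hX : ∀ x : X, IsPolynomialVector k x) : ModR k :=
  letI : Module (R k) X := Module.compHom X (coeffHom k)
  letI : Module k X := Module.compHom X (algebraMap k (R k))
  haveI : IsScalarTower k (R k) X := ⟨fun c a x => by
    rw [Algebra.smul_def, mul_smul]; rfl⟩
  let ρ : Representation k (GLinf k) X :=
    { toFun := fun g =>
        { toFun := fun x => (SkewMonoidAlgebra.single g 1 : SkewRing k) • x
          map_add' := smul_add _
          map_smul' := fun c x => by
            change (SkewMonoidAlgebra.single g 1 : SkewRing k) •
                (coeffHom k (algebraMap k (R k) c) • x) =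
              coeffHom k (algebraMap k (R k) c) • ((SkewMonoidAlgebra.single g 1 : SkewRing k) • x)
            rw [smul_smul, smul_smul, single_mul_coeffHom, actR_algebraMap] }
      map_one' := LinearMap.ext fun x => one_smul (SkewRing k) x
      map_mul' := fun g h => LinearMap.ext fun x => by
        change SkewMonoidAlgebra.single (g * h) (1 : R k) • x =
          SkewMonoidAlgebra.single g (1 : R k) • (SkewMonoidAlgebra.single h (1 : R k) • x)
        rw [smul_smul, SkewMonoidAlgebra.single_mul_single, smul_one, one_mul] }
  have hρ : ∀ (a : MonoidAlgebra k (GLinf k)) (x : X),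
      ρ.asAlgebraHom a x = groupAlgebraHom k a • x := by
    intro a x
    induction a using MonoidAlgebra.induction_linear with
    | zero => rw [map_zero, map_zero, zero_smul]; rfl
    | add a b ha hb => rw [map_add, map_add, add_smul, LinearMap.add_apply, ha, hb]
    | single g c =>
      rw [groupAlgebraHom_single, Representation.asAlgebraHom_single, ← coeffHom_mul_single,
        mul_smul]
      rfl
  { carrier := X
    ρ := ρ
    ρ_smul := fun g a x => by
      change (SkewMonoidAlgebra.single g 1 : SkewRing k) • (coeffHom k a • x) =
        coeffHom k (actR g a) • ((SkewMonoidAlgebra.single g 1 : SkewRing k) • x)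
      rw [smul_smul, smul_smul, single_mul_coeffHom]
    polynomial := isPolynomial_of_forall fun x => by
      obtain ⟨l, hl⟩ := hX x
      exact ⟨l, fun a ha => (hρ a x).trans (hl a ha)⟩ }

/-- The module over the skew group ring underlying `ofModule` is the given one. -/
def ofModuleEquiv (X : Type u) [AddCommGroup X] [Module (SkewRing k) X]
    (hX : ∀ x : X, IsPolynomialVector k x) : ofModule X hX ≃ₗ[SkewRing k] X :=
  { skewLinearMap (M := (ofModule X hX).carrier) (N := X) (AddMonoidHom.id X) fun g a x => by
      refine ((ofModule X hX).single_smul g a x).trans ?_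
      rw [← coeffHom_mul_single, mul_smul]
      rfl with
    invFun := fun x => x
    left_inv := fun _ => rfl
    right_inv := fun _ => rfl }

/-- The equivalence of `Mod_R` with polynomial modules over the skew group ring, as a functor. -/
def toPolyMod (k : Type u) [Field k] : ModR k ⥤ PolyMod k :=
  (polynomialModule k).lift (toModuleCat k) polynomialModule_toModuleCat

instance : (toPolyMod k).Full := inferInstanceAs ((polynomialModule k).lift _ _).Full

instance : (toPolyMod k).Faithful := inferInstanceAs ((polynomialModule k).lift _ _).Faithful

instance : (toPolyMod k).EssSurj where
  mem_essImage X := ⟨ofModule X.obj X.property, ⟨(polynomialModule k).isoMk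
    (ofModuleEquiv X.obj X.property).toModuleIso⟩⟩

instance : (toPolyMod k).IsEquivalence where

instance : HasColimitsOfSize.{u, u} (ModR k) where
  has_colimits_of_shape _ := Adjunction.hasColimitsOfShape_of_equivalence (toPolyMod k)

instance : HasFiniteProducts (ModR k) where
  out _ := Adjunction.hasLimitsOfShape_of_equivalence (toPolyMod k)

instance : Preadditive (ModR k) := .ofFullyFaithful (.ofFullyFaithful (toPolyMod k))

instance : Abelian (ModR k) := abelianOfEquivalence (toPolyMod k)

/-! ### Noetherian generators -/

/-- The left ideals of the skew group ring with polynomial quotient. -/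
def GeneratorIndex (k : Type u) [Field k] : Type u :=
  {I : Submodule (SkewRing k) (SkewRing k) //
    ∀ x : SkewRing k ⧸ I, IsPolynomialVector k x}

/-- The cyclic objects of `Mod_R`. -/
def generator (i : GeneratorIndex k) : ModR k := ofModule (SkewRing k ⧸ i.1) i.2

/-- The cyclic submodule through `m` is the skew group ring modulo the annihilator of `m`. Left
ideals form a type in universe `u`, so the family of cyclic objects is small. -/
theorem exists_generator_hom (M : ModR k) (m : M) :
    ∃ (i : GeneratorIndex k) (f : generator i ⟶ M) (x : generator i), f.toLin x = m := by
  let q : SkewRing k →ₗ[SkewRing k] M := LinearMap.toSpanSingleton (SkewRing k) M m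
  let j : (SkewRing k ⧸ LinearMap.ker q) →ₗ[SkewRing k] M := (LinearMap.ker q).liftQ q le_rfl
  have hj : Function.Injective j := by
    rw [← LinearMap.ker_eq_bot]
    exact Submodule.ker_liftQ_eq_bot _ _ _ le_rfl
  let i : GeneratorIndex k := ⟨LinearMap.ker q, fun x =>
    isPolynomialVector_of_finite (fun _ : Unit => j)
      (fun x hx => hj (by simpa using hx ())) fun _ => M.polynomialModule_toModuleCat _⟩
  let e : generator i ≃ₗ[SkewRing k] (SkewRing k ⧸ LinearMap.ker q) := ofModuleEquiv _ _
  obtain ⟨f, hf⟩ := (toModuleCat k).map_surjective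
    (ModuleCat.ofHom (j ∘ₗ e.toLinearMap) : (toModuleCat k).obj (generator i) ⟶ (toModuleCat k).obj M)
  refine ⟨i, f, e.symm (Submodule.Quotient.mk 1), ?_⟩
  have h1 : f.toLin (e.symm (Submodule.Quotient.mk 1)) =
      (j ∘ₗ e.toLinearMap) (e.symm (Submodule.Quotient.mk 1)) :=
    congrArg (fun f => f.hom (e.symm (Submodule.Quotient.mk 1))) hf
  rw [h1, LinearMap.comp_apply, LinearEquiv.coe_coe, LinearEquiv.apply_symm_apply]
  change q 1 = m
  exact LinearMap.toSpanSingleton_apply_one ..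

theorem isSeparating_generator : (ObjectProperty.ofObj (generator (k := k))).IsSeparating := by
  intro M N f g h
  apply Hom.ext
  ext m
  obtain ⟨i, φ, x, rfl⟩ := M.exists_generator_hom m
  exact congrArg (fun f : Hom _ _ => f.toLin x) (h (generator i) ⟨i⟩ φ)

theorem isNoetherian_generator (i : GeneratorIndex k) :
    IsNoetherian (SkewRing k) (generator i) := by
  let e : generator i ≃ₗ[SkewRing k] (SkewRing k ⧸ i.1) := ofModuleEquiv _ _
  have := (generator i).isNoetherian_span_singleton (e.symm (Submodule.Quotient.mk 1))
  have htop : Submodule.span (SkewRing k) {e.symm (Submodule.Quotient.mk 1)} = ⊤ := by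
    refine eq_top_iff.2 fun x _ => ?_
    obtain ⟨b, hb⟩ := Submodule.Quotient.mk_surjective i.1 (e x)
    refine Submodule.mem_span_singleton.2 ⟨b, e.injective ?_⟩
    rw [map_smul, LinearEquiv.apply_symm_apply, ← hb, ← Submodule.Quotient.mk_smul, smul_eq_mul,
      mul_one]
  rw [htop] at this
  exact isNoetherian_top_iff.1 this

end ModR

/-! ### Noetherian objects and local noetherianity of `Mod_R` -/

/-- Sending a subobject to its image under `F` preserves and, by full faithfulness, reflects the
order, so strictly ascending chains are carried to strictly ascending chains. -/
theorem isNoetherianObject_of_fullyFaithful {C D : Type*} [Category C] [Category D] (F : C ⥤ D)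
    [F.Full] [F.Faithful] [F.PreservesMonomorphisms] (X : C) [IsNoetherianObject (F.obj X)] :
    IsNoetherianObject X := by
  rw [isNoetherianObject_iff_not_strictMono]
  intro f hf
  let φ : Subobject X → Subobject (F.obj X) := fun S => Subobject.mk (F.map S.arrow)
  have hφ : ∀ S T, φ S ≤ φ T → S ≤ T := by
    intro S T h
    refine Subobject.le_of_comm (F.preimage (Subobject.ofMkLEMk _ _ h)) (F.map_injective ?_)
    rw [F.map_comp, F.map_preimage, Subobject.ofMkLEMk_comp]
  have hφ' : ∀ S T, S ≤ T → φ S ≤ φ T := fun S T h =>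
    Subobject.mk_le_mk_of_comm (F.map (Subobject.ofLE S T h)) (by
      rw [← F.map_comp, Subobject.ofLE_arrow])
  refine not_strictMono_of_isNoetherianObject (fun n => φ (f n)) fun a b hab => ?_
  exact lt_of_le_not_ge (hφ' _ _ (hf hab).le) fun h => (hf hab).not_ge (hφ _ _ h)

theorem isNoetherianObject_moduleCat {A : Type u} [Ring A] (M : ModuleCat.{v} A)
    [IsNoetherian A M] : IsNoetherianObject M := by
  have h : WellFoundedGT (Submodule A M) := inferInstance
  exact ⟨M.subobjectModule.toOrderEmbedding.wellFoundedGT⟩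

instance : (ModR.toModuleCat k).PreservesMonomorphisms :=
  inferInstanceAs (ModR.toPolyMod k ⋙ (polynomialModule k).ι).PreservesMonomorphisms

theorem isLocallyNoetherian_modR (k : Type u) [Field k] : IsLocallyNoetherian (ModR k) := by
  -- The coproduct of the small family of generators is a single separator.
  have : HasSeparator (ModR k) := ⟨_, ModR.isSeparating_generator.isSeparator_coproduct⟩
  have : HasSeparator (PolyMod k) := .of_equivalence (ModR.toPolyMod k).asEquivalence
  have : IsGrothendieckAbelian.{u} (PolyMod k) := {}
  refine ⟨inferInstance, .of_equivalence (ModR.toPolyMod k).asEquivalence.symm,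
    ModR.GeneratorIndex k, ModR.generator, ModR.isSeparating_generator, fun i => ?_⟩
  have : IsNoetherian (SkewRing k) ((ModR.toModuleCat k).obj (ModR.generator i)) :=
    ModR.isNoetherian_generator i
  have := isNoetherianObject_moduleCat ((ModR.toModuleCat k).obj (ModR.generator i))
  exact isNoetherianObject_of_fullyFaithful (ModR.toModuleCat k) _

end ExtNoeth

end

theorem mainTheorem4 (k : Type u) [Field k] [IsAlgClosed k] (p : ℕ) [Fact p.Prime] [CharP k p] :
    ExtNoeth.IsLocallyNoetherian (ExtNoeth.ModR k) ∧
    (∀ (M : ExtNoeth.ModR k), M.IsFG ⊤ →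
      ∀ N : Submodule (ExtNoeth.R k) M, M.IsStable N → M.IsFG N) ∧
    (∀ (n : ℕ) (N : Submodule (ExtNoeth.R k) (ExtNoeth.P k n)),
      ExtNoeth.IsIncStable N → ExtNoeth.IsIncFG N) := by
  refine ⟨ExtNoeth.isLocallyNoetherian_modR k, fun M hM N hN => ?_,
    fun n N hN => ExtNoeth.isIncFG_of_isIncStable hN⟩
  have := M.isNoetherian_of_isFG hM
  exact M.isFG_of_isNoetherian N hN
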